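/- Let $\Bbbk$ be an algebraically closed field of characteristic $0$, let $n\ge 2$ and $0\le t\le n-1$ be integers, let $\xi\in\Bbbk$ be a primitive $n$-th root of unity, and let $H=H(n,t,\xi)$ be the infinite-dimensional Taft algebra: the Hopf algebra generated by $x,g$ with relations $g^n=1$, $xg=\xi gx$, and with $\Delta(g)=g\otimes g$, $\varepsilon(g)=1$, $\Delta(x)=x\otimes g^t+1\otimes x$, $\varepsilon(x)=0$, $S(g)=g^{-1}$, $S(x)=-xg^{-t}$. Let $N$ be the multiplicative order of $\xi^t$, and for $a\in\mathbb Z$ let $\phi(a)$ be the unique integer in $\{1,\dots,N\}$ with $a\equiv\phi(a)\pmod N$. For $i,j\in\mathbb Z$ define elements $c_j^{i}(k,l)\in H$ for $0\le l\le k$ by $c_j^i(0,0)=g^i$ and $$c_j^i(k+1,l)=\begin{cases} c_j^i(k,0)S(x)+\xi^{tj}x\,c_j^i(k,0)S(g^t), & l=0,\\ c_j^i(k,l)S(x)+\xi^{t(j-l)}x\,c_j^i(k,l)S(g^t)+c_j^i(k,l-1)S(g^t), & 0<l<k+1,\\ c_j^i(k,k)S(g^t), & l=k+1.\end{cases}$$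 For $i,j\in\mathbb Z$ and $\lambda\in\Bbbk$ let $V(ti,j,\lambda)$ be the left-left Yetter-Drinfeld module over $H$ with basis $v_0,\dots,v_m$, where $m=N-\phi(-i-j)$ if $\lambda=0$ and $m=n-1$ if $\lambda\ne0$, with action $g\cdot v_k=\xi^{j-k}v_k$, $x\cdot v_k=v_{k+1}$ for $k<m$, $x\cdot v_m=\lambda v_0$, and coaction $\delta(v_k)=\sum_{l=0}^k c_j^{ti}(k,l)\otimes v_l$. Isomorphism of Yetter-Drinfeld modules means a linear bijection preserving the action and the coaction. Let $i,j,r,s\in\mathbb Z$, let $0\ne\lambda\in\Bbbk$, and put $p=N-\phi(-i-j)+1$. Then: 1. $V(ti,j,0)\cong V(tr,s,0)$ if and only if $i\equiv r\pmod N$ and $j\equiv s\pmod n$. 2. If $p=N$, then $V(ti,j,\lambda)\cong V(tr,s,\lambda)$ if and only if $i\equiv r\pmod N$ and $j\equiv s\pmod N$. 3. If $p<N$, then $V(ti,j,\lambda)\cong V(tr,s,\lambda)$ if and only if either (a) $i\equiv r\pmod N$ and $j\equiv s\pmod N$, or (b) $r\equiv i-p\pmod N$ and $s\equiv j-p\pmod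 N$. -/

import Mathlib

open TensorProduct

noncomputable section

universe u v

/-- The parameters of an infinite-dimensional Taft algebra `H(n, t, ξ)`: integers `n ≥ 2` and
`0 ≤ t ≤ n - 1`, and a primitive `n`-th root of unity `ξ`. -/
structure TaftParams (k : Type u) [Field k] where
  n : ℕ
  t : ℕ
  ξ : k
  two_le_n : 2 ≤ n
  t_lt_n : t < n
  primitive : IsPrimitiveRoot ξ n

/-- The two generators `x` and `g`. -/
inductive TaftGen : Type
  | x
  | g

section Algebra

variable {k : Type u} [Field k] (P : TaftParams k)

/-- The defining relations `g ^ n = 1` and `x g = ξ g x`. -/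
inductive TaftRel : FreeAlgebra k TaftGen → FreeAlgebra k TaftGen → Prop
  | g_pow : TaftRel (FreeAlgebra.ι k TaftGen.g ^ P.n) 1
  | x_mul_g : TaftRel (FreeAlgebra.ι k TaftGen.x * FreeAlgebra.ι k TaftGen.g)
      (P.ξ • (FreeAlgebra.ι k TaftGen.g * FreeAlgebra.ι k TaftGen.x))

/-- The algebra `H(n, t, ξ)`: generated by `x` and `g` subject to `g ^ n = 1`, `x g = ξ g x`. -/
def TaftAlg : Type u := RingQuot (TaftRel P)

instance : Ring (TaftAlg P) := inferInstanceAs (Ring (RingQuot (TaftRel P)))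

instance : Algebra k (TaftAlg P) := inferInstanceAs (Algebra k (RingQuot (TaftRel P)))

namespace TaftAlg

/-- The generator `x`. -/
def x : TaftAlg P := RingQuot.mkAlgHom k (TaftRel P) (FreeAlgebra.ι k TaftGen.x)

/-- The generator `g`. -/
def g : TaftAlg P := RingQuot.mkAlgHom k (TaftRel P) (FreeAlgebra.ι k TaftGen.g)

theorem g_pow_n : g P ^ P.n = 1 := by
  have h := RingQuot.mkAlgHom_rel k (TaftRel.g_pow (P := P))
  rw [map_pow, map_one] at h
  exact h

theorem x_mul_g : x P * g P = P.ξ • (g P * x P) := by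
  have h := RingQuot.mkAlgHom_rel k (TaftRel.x_mul_g (P := P))
  rw [map_mul, map_smul, map_mul] at h
  exact h

/-- `g` as a unit. -/
def gUnit : (TaftAlg P)ˣ where
  val := g P
  inv := g P ^ (P.n - 1)
  val_inv := by
    rw [← pow_succ', Nat.sub_add_cancel (by have := P.two_le_n; omega), g_pow_n]
  inv_val := by
    rw [← pow_succ, Nat.sub_add_cancel (by have := P.two_le_n; omega), g_pow_n]

/-- The integer power `g ^ a` in `H`. -/
def gz (a : ℤ) : TaftAlg P := ((gUnit P ^ a : (TaftAlg P)ˣ) : TaftAlg P)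

theorem gz_zero : gz P 0 = 1 := by simp [gz]

theorem gz_one : gz P 1 = g P := by simp [gz, gUnit]

theorem gz_add (a b : ℤ) : gz P (a + b) = gz P a * gz P b := by simp [gz, zpow_add]

theorem gz_natCast (a : ℕ) : gz P a = g P ^ a := by
  simp [gz, gUnit]

variable {P}

section lift
variable {A : Type*} [Ring A] [Algebra k A]

/-- The universal property of the presentation. -/
def lift (a b : A) (hb : b ^ P.n = 1) (hab : a * b = P.ξ • (b * a)) : TaftAlg P →ₐ[k] A :=
  RingQuot.liftAlgHom k ⟨FreeAlgebra.lift k (fun s => match s with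
    | TaftGen.x => a
    | TaftGen.g => b), by
      intro u v h
      cases h with
      | g_pow => simp [hb]
      | x_mul_g => simp [hab]⟩

theorem lift_x (a b : A) (hb : b ^ P.n = 1) (hab : a * b = P.ξ • (b * a)) :
    lift a b hb hab (x P) = a := by
  simp only [lift, x]
  erw [RingQuot.liftAlgHom_mkAlgHom_apply]
  simp

theorem lift_g (a b : A) (hb : b ^ P.n = 1) (hab : a * b = P.ξ • (b * a)) :
    lift a b hb hab (g P) = b := by
  simp only [lift, g]
  erw [RingQuot.liftAlgHom_mkAlgHom_apply]
  simp

theorem hom_ext {f₁ f₂ : TaftAlg P →ₐ[k] A} (hx : f₁ (x P) = f₂ (x P))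
    (hg : f₁ (g P) = f₂ (g P)) : f₁ = f₂ := by
  apply RingQuot.ringQuot_ext'
  apply FreeAlgebra.hom_ext
  funext s
  cases s with
  | x => exact hx
  | g => exact hg

end lift

theorem induct {C : TaftAlg P → Prop} (hx : C (x P)) (hg : C (g P))
    (hs : ∀ r : k, C (algebraMap k _ r)) (hadd : ∀ a b, C a → C b → C (a + b))
    (hmul : ∀ a b, C a → C b → C (a * b)) (a : TaftAlg P) : C a := by
  obtain ⟨a, rfl⟩ := RingQuot.mkAlgHom_surjective k (TaftRel P) a
  induction a using FreeAlgebra.induction with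
  | grade0 r =>
    rw [AlgHom.commutes]
    exact hs r
  | grade1 s =>
    cases s with
    | x => exact hx
    | g => exact hg
  | mul a b ha hb => rw [map_mul]; exact hmul _ _ ha hb
  | add a b ha hb => rw [map_add]; exact hadd _ _ ha hb

variable (P)

theorem gz_mul_x (a : ℤ) : gz P a * x P = P.ξ ^ (-a) • (x P * gz P a) := by
  have hξ : P.ξ ≠ 0 := P.primitive.ne_zero (by have := P.two_le_n; omega)
  have h1 : gz P 1 * x P = P.ξ ^ (-1 : ℤ) • (x P * gz P 1) := by
    rw [gz_one, x_mul_g, smul_smul]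
    simp [hξ]
  have h2 : gz P (-1) * x P = P.ξ ^ (1 : ℤ) • (x P * gz P (-1)) := by
    have e1 : gz P 1 * gz P (-1) = 1 := by rw [← gz_add]; simp [gz_zero]
    have e2 : gz P (-1) * gz P 1 = 1 := by rw [← gz_add]; simp [gz_zero]
    calc gz P (-1) * x P = gz P (-1) * (x P * g P) * gz P (-1) := by
          rw [← gz_one, mul_assoc, mul_assoc, e1, mul_one]
      _ = P.ξ ^ (1 : ℤ) • (x P * gz P (-1)) := by
          rw [x_mul_g, ← gz_one, mul_smul_comm, ← mul_assoc, e2, one_mul, smul_mul_assoc, zpow_one]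
  induction a using Int.induction_on with
  | zero => simp [gz_zero]
  | succ a ih =>
    rw [gz_add, mul_assoc, h1, mul_smul_comm, ← mul_assoc, ih, smul_mul_assoc, smul_smul,
      mul_assoc, neg_add, zpow_add₀ hξ, mul_comm]
  | pred a ih =>
    rw [sub_eq_add_neg, gz_add, mul_assoc, h2, mul_smul_comm, ← mul_assoc, ih, smul_mul_assoc,
      smul_smul, mul_assoc, neg_add, neg_neg (1 : ℤ), zpow_add₀ hξ, mul_comm]

/-- Comultiplication: `Δ(x) = x ⊗ g ^ t + 1 ⊗ x`, `Δ(g) = g ⊗ g`. -/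
def comulHom : TaftAlg P →ₐ[k] TaftAlg P ⊗[k] TaftAlg P :=
  lift (x P ⊗ₜ (g P ^ P.t) + 1 ⊗ₜ x P) (g P ⊗ₜ g P)
    (by rw [Algebra.TensorProduct.tmul_pow, g_pow_n, Algebra.TensorProduct.one_def])
    (by
      simp only [add_mul, mul_add, Algebra.TensorProduct.tmul_mul_tmul, x_mul_g, one_mul, mul_one,
        smul_add, pow_mul_comm', TensorProduct.smul_tmul', TensorProduct.tmul_smul])

/-- Counit: `ε(x) = 0`, `ε(g) = 1`. -/
def counitHom : TaftAlg P →ₐ[k] k :=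
  lift 0 1 (one_pow _) (by simp)

/-- The antipode as an algebra map to the opposite algebra: `S(x) = - x g ^ (-t)`,
`S(g) = g ^ (-1)`. -/
def antipodeHom : TaftAlg P →ₐ[k] (TaftAlg P)ᵐᵒᵖ :=
  lift (MulOpposite.op (-(x P * gz P (-P.t)))) (MulOpposite.op (gz P (-1)))
    (by
      rw [← MulOpposite.op_pow, ← MulOpposite.op_one]
      congr 1
      have h : gz P (-1) ^ P.n * g P ^ P.n = 1 := by
        rw [← gz_one, gz, gz, ← Units.val_pow_eq_pow_val, ← Units.val_pow_eq_pow_val,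
          ← Units.val_mul]
        simp
      rwa [g_pow_n, mul_one] at h)
    (by
      rw [← MulOpposite.op_mul, ← MulOpposite.op_mul, ← MulOpposite.op_smul]
      congr 1
      rw [mul_neg, neg_mul, smul_neg, ← mul_assoc, gz_mul_x, neg_neg, zpow_one, smul_mul_assoc,
        mul_assoc, mul_assoc, ← gz_add, ← gz_add, add_comm])

theorem comulHom_x : comulHom P (x P) = x P ⊗ₜ (g P ^ P.t) + 1 ⊗ₜ x P := lift_x _ _ _ _
theorem comulHom_g : comulHom P (g P) = g P ⊗ₜ g P := lift_g _ _ _ _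
theorem counitHom_x : counitHom P (x P) = 0 := lift_x _ _ _ _
theorem counitHom_g : counitHom P (g P) = 1 := lift_g _ _ _ _

instance : Bialgebra k (TaftAlg P) :=
  Bialgebra.ofAlgHom (comulHom P) (counitHom P)
    (by
      apply hom_ext
      · simp [comulHom_x, comulHom_g, TensorProduct.add_tmul, TensorProduct.tmul_add,
          Algebra.TensorProduct.one_def, Algebra.TensorProduct.tmul_pow, add_assoc]
      · simp [comulHom_g])
    (by
      apply hom_ext
      · simp [comulHom_x, counitHom_x]
      · simp [comulHom_g, counitHom_g])
    (by
      apply hom_ext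
      · simp [comulHom_x, counitHom_x, counitHom_g]
      · simp [comulHom_g, counitHom_g])

theorem comul_x : Coalgebra.comul (R := k) (x P) = x P ⊗ₜ (g P ^ P.t) + 1 ⊗ₜ x P := comulHom_x P
theorem comul_g : Coalgebra.comul (R := k) (g P) = g P ⊗ₜ g P := comulHom_g P
theorem counit_x : Coalgebra.counit (R := k) (x P) = 0 := counitHom_x P
theorem counit_g : Coalgebra.counit (R := k) (g P) = 1 := counitHom_g P

/-- The antipode as a linear map. -/
def S : TaftAlg P →ₗ[k] TaftAlg P :=
  (MulOpposite.opLinearEquiv k).symm.toLinearMap ∘ₗ (antipodeHom P).toLinearMap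

theorem S_x : S P (x P) = -(x P * gz P (-P.t)) := by
  simp [S, antipodeHom, lift_x]

theorem S_g : S P (g P) = gz P (-1) := by
  simp [S, antipodeHom, lift_g]

theorem S_mul (a b : TaftAlg P) : S P (a * b) = S P b * S P a := by
  simp [S]

theorem S_algebraMap (r : k) : S P (algebraMap k _ r) = algebraMap k _ r := by
  simp only [S, LinearMap.comp_apply, AlgHom.toLinearMap_apply, AlgHom.commutes]
  rfl

theorem S_one : S P 1 = 1 := by
  simpa using S_algebraMap P 1

theorem S_g_pow (a : ℕ) : S P (g P ^ a) = gz P (-a) := by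
  induction a with
  | zero => simp [S_one, gz_zero]
  | succ a ih => rw [pow_succ, S_mul, ih, S_g, ← gz_add]; congr 1; push_cast; ring

theorem antipode_left_aux (u w : TaftAlg P ⊗[k] TaftAlg P) (e : k)
    (hu : LinearMap.mul' k _ ((S P).rTensor _ u) = algebraMap k _ e) :
    LinearMap.mul' k _ ((S P).rTensor _ (u * w))
      = e • LinearMap.mul' k _ ((S P).rTensor _ w) := by
  induction w using TensorProduct.induction_on with
  | zero => simp
  | add w₁ w₂ h₁ h₂ => rw [mul_add, map_add, map_add, h₁, h₂, map_add, map_add, smul_add]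
  | tmul c d =>
    have key : ∀ u : TaftAlg P ⊗[k] TaftAlg P,
        LinearMap.mul' k _ ((S P).rTensor _ (u * c ⊗ₜ d))
          = S P c * LinearMap.mul' k _ ((S P).rTensor _ u) * d := by
      intro u
      induction u using TensorProduct.induction_on with
      | zero => simp
      | add u₁ u₂ h₁ h₂ => simp only [add_mul, map_add, mul_add, h₁, h₂]
      | tmul a b => simp [S_mul, mul_assoc]
    rw [key, hu, ← Algebra.commutes, mul_assoc, ← Algebra.smul_def]
    simp

theorem antipode_right_aux (u w : TaftAlg P ⊗[k] TaftAlg P) (e : k)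
    (hw : LinearMap.mul' k _ ((S P).lTensor _ w) = algebraMap k _ e) :
    LinearMap.mul' k _ ((S P).lTensor _ (u * w))
      = e • LinearMap.mul' k _ ((S P).lTensor _ u) := by
  induction u using TensorProduct.induction_on with
  | zero => simp
  | add w₁ w₂ h₁ h₂ => rw [add_mul, map_add, map_add, h₁, h₂, map_add, map_add, smul_add]
  | tmul c d =>
    have key : ∀ w : TaftAlg P ⊗[k] TaftAlg P,
        LinearMap.mul' k _ ((S P).lTensor _ (c ⊗ₜ d * w))
          = c * LinearMap.mul' k _ ((S P).lTensor _ w) * S P d := by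
      intro u
      induction u using TensorProduct.induction_on with
      | zero => simp
      | add u₁ u₂ h₁ h₂ => simp only [add_mul, map_add, mul_add, h₁, h₂]
      | tmul a b => simp [S_mul, mul_assoc]
    rw [key, hw, ← Algebra.commutes, mul_assoc, ← Algebra.smul_def]
    simp

/-- The Hopf algebra structure of `H(n, t, ξ)`. -/
instance : HopfAlgebra k (TaftAlg P) where
  antipode := S P
  mul_antipode_rTensor_comul := by
    ext a
    change LinearMap.mul' k _ ((S P).rTensor _ (Coalgebra.comul a))
      = algebraMap k _ (Coalgebra.counit a)
    induction a using induct with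
    | hx =>
      rw [comul_x, counit_x]
      simp only [map_add, LinearMap.rTensor_tmul, LinearMap.mul'_apply, S_x, S_one, one_mul,
        map_zero, neg_mul]
      rw [← gz_natCast, mul_assoc, ← gz_add]
      simp [gz_zero]
    | hg =>
      rw [comul_g, counit_g]
      simp only [LinearMap.rTensor_tmul, LinearMap.mul'_apply, S_g, map_one]
      rw [← gz_one, ← gz_add]
      simp [gz_zero]
    | hs r => simp [S_algebraMap, Algebra.TensorProduct.algebraMap_apply]
    | hadd a b ha hb => simp only [map_add, ha, hb]
    | hmul a b ha hb =>
      rw [Bialgebra.comul_mul, antipode_left_aux P _ _ _ ha, hb, Bialgebra.counit_mul, map_mul,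
        Algebra.smul_def]
  mul_antipode_lTensor_comul := by
    ext a
    change LinearMap.mul' k _ ((S P).lTensor _ (Coalgebra.comul a))
      = algebraMap k _ (Coalgebra.counit a)
    induction a using induct with
    | hx =>
      rw [comul_x, counit_x]
      simp [S_x, S_g_pow]
    | hg =>
      rw [comul_g, counit_g]
      simp only [LinearMap.lTensor_tmul, LinearMap.mul'_apply, S_g, map_one]
      rw [← gz_one, ← gz_add]
      simp [gz_zero]
    | hs r => simp [S_one, Algebra.TensorProduct.algebraMap_apply]
    | hadd a b ha hb => simp only [map_add, ha, hb]
    | hmul a b ha hb =>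
      rw [Bialgebra.comul_mul, antipode_right_aux P _ _ _ hb, ha, Bialgebra.counit_mul, mul_comm,
        map_mul, Algebra.smul_def]

theorem antipode_x : HopfAlgebra.antipode k (x P) = -(x P * gz P (-P.t)) := S_x P

theorem antipode_g_pow (a : ℕ) : HopfAlgebra.antipode k (g P ^ a) = gz P (-a) := S_g_pow P a

end TaftAlg

end Algebra

section YetterDrinfeld

variable {k : Type u} [Field k] {H : Type v} [Ring H] [HopfAlgebra k H]

/-- For an action of `H` on `V`, the linear extension of
`a ⊗ (b ⊗ c) ↦ (h ⊗ v ↦ a h S(c) ⊗ b · v)`. -/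
def ydOp {V : Type*} [AddCommGroup V] [Module k V] (act : H →ₐ[k] Module.End k V) :
    H ⊗[k] (H ⊗[k] H) →ₗ[k] Module.End k (H ⊗[k] V) :=
  TensorProduct.lift (LinearMap.mk₂ k
    (fun (a : H) (u : H ⊗[k] H) =>
      (LinearMap.mulLeft k a).rTensor V ∘ₗ
        TensorProduct.lift (LinearMap.mk₂ k
          (fun b c : H => TensorProduct.map
            (LinearMap.mulRight k (HopfAlgebra.antipode k c)) (act b))
          (by intro b b' c; ext; simp [TensorProduct.tmul_add])
          (by intro r b c; ext; simp)
          (by intro b c c'; ext; simp [mul_add, TensorProduct.add_tmul])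
          (by intro r b c; ext; simp [TensorProduct.smul_tmul'])) u)
    (by
      intro a a' u
      have e : LinearMap.mulLeft k (a + a') = LinearMap.mulLeft k a + LinearMap.mulLeft k a' := by
        ext; simp [add_mul]
      apply TensorProduct.ext'
      intro h v
      simp [LinearMap.rTensor_add, e])
    (by
      intro r a u
      have e : LinearMap.mulLeft k (r • a) = r • LinearMap.mulLeft k a := by
        ext; simp
      apply TensorProduct.ext'
      intro h v
      simp [LinearMap.rTensor_smul, e])
    (by intro a u u'; simp [LinearMap.comp_add])
    (by intro r a u; simp [LinearMap.comp_smul]))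

theorem ydOp_tmul {V : Type*} [AddCommGroup V] [Module k V] (act : H →ₐ[k] Module.End k V)
    (a b c h : H) (v : V) :
    ydOp act (a ⊗ₜ (b ⊗ₜ c)) (h ⊗ₜ v) = (a * h * HopfAlgebra.antipode k c) ⊗ₜ act b v := by
  simp [ydOp, mul_assoc]

/-- A left-left Yetter-Drinfeld module over the Hopf algebra `H`: a vector space with a left
`H`-action (`act`), a left `H`-coaction (`coact`), and the compatibility condition
`δ(h · v) = h₁ v₋₁ S(h₃) ⊗ h₂ · v₀`. -/
structure YDModule (k : Type u) [Field k] (H : Type v) [Ring H] [HopfAlgebra k H] where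
  carrier : Type u
  [addCommGroup : AddCommGroup carrier]
  [module : Module k carrier]
  act : H →ₐ[k] Module.End k carrier
  coact : carrier →ₗ[k] H ⊗[k] carrier
  coassoc : ∀ v, TensorProduct.assoc k H H carrier
    ((Coalgebra.comul (R := k) (A := H)).rTensor carrier (coact v)) = coact.lTensor H (coact v)
  counit : ∀ v, TensorProduct.lid k carrier
    ((Coalgebra.counit (R := k) (A := H)).rTensor carrier (coact v)) = v
  compat : ∀ (h : H) (v : carrier), coact (act h v) =
    ydOp act ((Coalgebra.comul (R := k) (A := H)).lTensor H (Coalgebra.comul (R := k) h)) (coact v)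

attribute [instance] YDModule.addCommGroup YDModule.module

/-- Isomorphism of Yetter-Drinfeld modules: a bijective linear map preserving both the action and
the coaction. -/
def YDModule.IsIso (V W : YDModule k H) : Prop :=
  ∃ f : V.carrier ≃ₗ[k] W.carrier,
    (∀ (h : H) (v : V.carrier), f (V.act h v) = W.act h (f v)) ∧
    (∀ v : V.carrier, W.coact (f v) = f.toLinearMap.lTensor H (V.coact v))

theorem ydOp_mul {V : Type*} [AddCommGroup V] [Module k V] (act : H →ₐ[k] Module.End k V)
    (u w : H ⊗[k] (H ⊗[k] H)) : ydOp act (u * w) = ydOp act u * ydOp act w := by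
  induction u using TensorProduct.induction_on with
  | zero => simp
  | add u₁ u₂ h₁ h₂ => simp only [add_mul, map_add, h₁, h₂]
  | tmul a u =>
    induction u using TensorProduct.induction_on with
    | zero => simp
    | add u₁ u₂ h₁ h₂ => simp only [TensorProduct.tmul_add, add_mul, map_add, h₁, h₂]
    | tmul b c =>
      induction w using TensorProduct.induction_on with
      | zero => simp
      | add u₁ u₂ h₁ h₂ => simp only [mul_add, map_add, h₁, h₂]
      | tmul a' w =>
        induction w using TensorProduct.induction_on with
        | zero => simp
        | add u₁ u₂ h₁ h₂ => simp only [TensorProduct.tmul_add, mul_add, map_add, h₁, h₂]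
        | tmul b' c' =>
          apply TensorProduct.ext'
          intro h v
          rw [Module.End.mul_apply, ydOp_tmul, Algebra.TensorProduct.tmul_mul_tmul,
            Algebra.TensorProduct.tmul_mul_tmul, ydOp_tmul, ydOp_tmul,
            HopfAlgebra.antipode_mul_antidistrib, map_mul, Module.End.mul_apply]
          simp only [mul_assoc]

/-- The iterated comultiplication `h ↦ h₁ ⊗ (h₂ ⊗ h₃)` is multiplicative. -/
theorem comul_comul_mul (h h' : H) :
    (Coalgebra.comul (R := k) (A := H)).lTensor H (Coalgebra.comul (R := k) (h * h')) =
    (Coalgebra.comul (R := k) (A := H)).lTensor H (Coalgebra.comul (R := k) h) *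
    (Coalgebra.comul (R := k) (A := H)).lTensor H (Coalgebra.comul (R := k) h') := by
  have key : ∀ u : H ⊗[k] H, (Coalgebra.comul (R := k) (A := H)).lTensor H u =
      Algebra.TensorProduct.map (AlgHom.id k H) (Bialgebra.comulAlgHom k H) u := by
    intro u; rfl
  rw [Bialgebra.comul_mul, key, key, key, map_mul]

end YetterDrinfeld

section Modules

variable {k : Type u} [Field k] (P : TaftParams k)

namespace TaftParams

/-- `N` is the order of `ξ ^ t`. -/
def N : ℕ := orderOf (P.ξ ^ P.t)

/-- `φ(i)` is the integer in `{1, …, N}` congruent to `i` modulo `N`. -/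
def phi (i : ℤ) : ℕ := ((i - 1) % (P.N : ℤ)).toNat + 1

end TaftParams

namespace TaftAlg

/-- The coefficients `c_j^i(k, l) ∈ H`, extended by `0` to `l > k`; with this extension the
recursion for `0 < l < k + 1` also covers the case `l = k + 1`, where it reads
`c_j^i(k + 1, k + 1) = c_j^i(k, k) S(g ^ t)` (see `coef_of_lt` and `coef_succ_self` below). -/
def coef (i j : ℤ) : ℕ → ℕ → TaftAlg P
  | 0, 0 => gz P i
  | 0, _ + 1 => 0
  | a + 1, 0 =>
      coef i j a 0 * HopfAlgebra.antipode k (x P) +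
        P.ξ ^ (P.t * j) • (x P * coef i j a 0 * HopfAlgebra.antipode k (g P ^ P.t))
  | a + 1, l + 1 =>
      coef i j a (l + 1) * HopfAlgebra.antipode k (x P) +
        P.ξ ^ (P.t * (j - (l + 1 : ℕ))) •
          (x P * coef i j a (l + 1) * HopfAlgebra.antipode k (g P ^ P.t)) +
        coef i j a l * HopfAlgebra.antipode k (g P ^ P.t)

/-- The scalars `λ_j^i(k, l)` with `c_j^i(k, l) = λ_j^i(k, l) x ^ (k - l) g ^ (i - k t)`. -/
def lamC (i j : ℤ) : ℕ → ℕ → k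
  | 0, 0 => 1
  | 0, _ + 1 => 0
  | a + 1, 0 => (P.ξ ^ (P.t * j) - P.ξ ^ (P.t * a - i)) * lamC i j a 0
  | a + 1, l + 1 => (P.ξ ^ (P.t * (j - (l + 1 : ℕ))) - P.ξ ^ (P.t * a - i)) * lamC i j a (l + 1) +
      lamC i j a l

theorem lamC_of_lt (i j : ℤ) (a : ℕ) : ∀ l, a < l → lamC P i j a l = 0 := by
  induction a with
  | zero => intro l hl; obtain ⟨l, rfl⟩ := Nat.exists_eq_succ_of_ne_zero hl.ne'; simp [lamC]
  | succ a ih =>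
    intro l hl
    obtain ⟨l, rfl⟩ := Nat.exists_eq_succ_of_ne_zero (show l ≠ 0 by omega)
    simp [lamC, ih (l + 1) (by omega), ih l (by omega)]

theorem lamC_self (i j : ℤ) (a : ℕ) : lamC P i j a a = 1 := by
  induction a with
  | zero => simp [lamC]
  | succ a ih => simp [lamC, ih, lamC_of_lt]

theorem coef_aux (i : ℤ) (a b : ℕ) (r s : k) :
    (r • (x P ^ b * gz P (i - a * P.t))) * HopfAlgebra.antipode k (x P) +
      s • (x P * (r • (x P ^ b * gz P (i - a * P.t))) * HopfAlgebra.antipode k (g P ^ P.t)) =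
    ((s - P.ξ ^ (P.t * a - i)) * r) • (x P ^ (b + 1) * gz P (i - (a + 1 : ℕ) * P.t)) := by
  have e : i - (a + 1 : ℕ) * P.t = (i - a * P.t) + (-P.t) := by push_cast; ring
  rw [antipode_x, antipode_g_pow, e, gz_add]
  simp only [mul_neg, smul_mul_assoc, mul_smul_comm, smul_smul]
  have h1 : x P ^ b * gz P (i - a * P.t) * (x P * gz P (-P.t)) =
      P.ξ ^ (P.t * a - i) • (x P ^ (b + 1) * (gz P (i - a * P.t) * gz P (-P.t))) := by
    rw [mul_assoc, ← mul_assoc (gz P _), gz_mul_x, smul_mul_assoc, mul_smul_comm, pow_succ]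
    simp only [mul_assoc]
    congr 2
    ring
  have h2 : x P * (x P ^ b * gz P (i - a * P.t)) * gz P (-P.t) =
      x P ^ (b + 1) * (gz P (i - a * P.t) * gz P (-P.t)) := by
    rw [pow_succ']
    simp only [mul_assoc]
  rw [h1, h2, smul_smul, ← neg_smul, ← add_smul]
  congr 1
  ring

theorem coef_eq (i j : ℤ) (a : ℕ) : ∀ l,
    coef P i j a l = lamC P i j a l • (x P ^ (a - l) * gz P (i - a * P.t)) := by
  induction a with
  | zero =>
    intro l
    cases l with
    | zero => simp [coef, lamC]
    | succ l => simp [coef, lamC]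
  | succ a ih =>
    intro l
    cases l with
    | zero =>
      rw [coef, ih, coef_aux, lamC]
      rfl
    | succ l =>
      have e : i - (a + 1 : ℕ) * P.t = (i - a * P.t) + (-P.t) := by push_cast; ring
      rw [coef, ih, coef_aux, ih l, lamC, add_smul]
      congr 1
      · rcases Nat.lt_or_ge l a with h | h
        · congr 3
          omega
        · rw [lamC_of_lt P i j a (l + 1) (by omega)]
          simp
      · rw [antipode_g_pow, smul_mul_assoc, mul_assoc, ← gz_add, e, Nat.add_sub_add_right]

theorem coef_of_lt (i j : ℤ) {a l : ℕ} (h : a < l) : coef P i j a l = 0 := by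
  rw [coef_eq, lamC_of_lt P i j a l h, zero_smul]

theorem coef_succ_self (i j : ℤ) (a : ℕ) :
    coef P i j (a + 1) (a + 1) = coef P i j a a * HopfAlgebra.antipode k (g P ^ P.t) := by
  rw [coef, coef_of_lt P i j (Nat.lt_succ_self a)]
  simp

/-- Auxiliary twisted binomial coefficients. -/
def binC (u : k) : ℕ → ℕ → k
  | _, 0 => 1
  | 0, _ + 1 => 0
  | a + 1, l + 1 => u ^ (l + 1) * binC u a (l + 1) + binC u a l

theorem binC_pascal (u w : k) (h : u * w = 1) (a : ℕ) : ∀ l,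
    w ^ a * binC u (a + 1) (l + 1) = w ^ a * binC u a (l + 1) + w ^ l * binC u a l := by
  induction a with
  | zero =>
    intro l
    cases l with
    | zero => simp [binC]
    | succ l => simp [binC]
  | succ a ih =>
    intro l
    cases l with
    | zero =>
      have h0 := ih 0
      rw [binC, binC.eq_3 u a]
      simp only [binC, zero_add, pow_one, pow_zero, mul_one, pow_succ] at h0 ⊢
      linear_combination h0 * w * u + h
    | succ l =>
      have h0 := ih l
      have h1 := ih (l + 1)
      rw [binC, binC.eq_3 u a (l + 1)]
      rw [binC.eq_3 u a l]
      rw [binC.eq_3 u a l] at h0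
      rw [binC.eq_3 u a (l + 1)] at h1
      linear_combination (w * u ^ (l + 2)) * h1 + w * h0 +
        h * (u ^ (l + 1) * w ^ (l + 1) * binC u a (l + 1))

theorem xi_ne_zero : P.ξ ≠ 0 := P.primitive.ne_zero (by have := P.two_le_n; omega)

theorem lamC_formula (i j : ℤ) (a : ℕ) : ∀ l, l ≤ a →
    lamC P i j a l = binC (P.ξ ^ P.t)⁻¹ a l *
      ∏ s ∈ Finset.Ico l a, (P.ξ ^ (P.t * j) - P.ξ ^ (P.t * s - i)) := by
  have hw : P.ξ ^ P.t ≠ 0 := pow_ne_zero _ (xi_ne_zero P)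
  induction a with
  | zero => intro l hl; obtain rfl : l = 0 := by omega
            simp [lamC, binC]
  | succ a ih =>
    intro l hl
    cases l with
    | zero =>
      rw [lamC, ih 0 (by omega), Finset.prod_Ico_succ_top (by omega)]
      simp only [binC]
      ring
    | succ l =>
      rcases Nat.lt_or_ge l a with h | h
      · rw [lamC, ih (l + 1) (by omega), ih l (by omega), Finset.prod_Ico_succ_top (by omega),
          Finset.prod_eq_prod_Ico_succ_bot h]
        have e1 : P.ξ ^ (P.t * (j - (l + 1 : ℕ))) =
            P.ξ ^ (P.t * j) * (P.ξ ^ P.t)⁻¹ ^ (l + 1) := by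
          rw [mul_sub, zpow_sub₀ (xi_ne_zero P), zpow_mul P.ξ P.t ((l + 1 : ℕ) : ℤ), zpow_natCast,
            zpow_natCast, inv_pow, div_eq_mul_inv]
        have e2 : ∀ s : ℕ, P.ξ ^ (P.t * s - i) = P.ξ ^ (-i) * (P.ξ ^ P.t) ^ s := by
          intro s
          rw [sub_eq_neg_add, zpow_add₀ (xi_ne_zero P), zpow_mul P.ξ P.t (s : ℤ), zpow_natCast,
            zpow_natCast]
        have hp := binC_pascal (P.ξ ^ P.t)⁻¹ (P.ξ ^ P.t) (inv_mul_cancel₀ hw) a l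
        rw [e1, e2 a, e2 l]
        have hd := binC.eq_3 (P.ξ ^ P.t)⁻¹ a l
        set Q := ∏ s ∈ Finset.Ico (l + 1) a, (P.ξ ^ (P.t * j) - P.ξ ^ (P.t * s - i))
        linear_combination (- P.ξ ^ (P.t * j) * Q) * hd + (P.ξ ^ (-i) * Q) * hp
      · obtain rfl : l = a := by omega
        have hb : ∀ m l' : ℕ, m < l' → binC (P.ξ ^ P.t)⁻¹ m l' = 0 := by
          intro m
          induction m with
          | zero => intro l' h'; obtain ⟨l', rfl⟩ := Nat.exists_eq_succ_of_ne_zero h'.ne'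
                    simp [binC]
          | succ m ih' =>
            intro l' h'
            obtain ⟨l', rfl⟩ := Nat.exists_eq_succ_of_ne_zero (show l' ≠ 0 by omega)
            simp [binC, ih' (l' + 1) (by omega), ih' l' (by omega)]
        have hb1 : ∀ m : ℕ, binC (P.ξ ^ P.t)⁻¹ m m = 1 := by
          intro m
          induction m with
          | zero => simp [binC]
          | succ m ih' => simp [binC, ih', hb]
        rw [lamC_self, hb1]
        simp

/-- Row `q` of the coefficients `λ_j^{ti}` vanishes below the diagonal. -/
def ZeroRow (i j : ℤ) (q : ℕ) : Prop := ∀ l, l < q → lamC P (P.t * i) j q l = 0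

theorem zeroRow_of_eq (i j : ℤ) (q : ℕ) (hq : 1 ≤ q)
    (h : P.ξ ^ (P.t * j) = P.ξ ^ (P.t * ((q - 1 : ℕ) : ℤ) - P.t * i)) : ZeroRow P i j q := by
  intro l hl
  rw [lamC_formula P _ _ _ _ hl.le]
  rw [Finset.prod_eq_zero (i := q - 1) (by simp; omega) (by rw [h, sub_self]), mul_zero]

theorem lamC_shift (i j : ℤ) (q : ℕ) (h : ZeroRow P i j q) (a : ℕ) :
    (∀ l, lamC P (P.t * i) j (q + a) (q + l) = lamC P (P.t * (i - q)) (j - q) a l) ∧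
    (∀ l, l < q → lamC P (P.t * i) j (q + a) l = 0) := by
  induction a with
  | zero =>
    refine ⟨fun l => ?_, fun l hl => h l hl⟩
    cases l with
    | zero => simp [lamC_self, lamC]
    | succ l => rw [lamC_of_lt _ _ _ _ _ (by omega)]; simp [lamC]
  | succ a ih =>
    obtain ⟨ih1, ih2⟩ := ih
    have hlow : ∀ l, l < q → lamC P (P.t * i) j (q + (a + 1)) l = 0 := by
      intro l hl
      rw [← add_assoc]
      cases l with
      | zero => rw [lamC, ih2 0 hl, mul_zero]
      | succ l => rw [lamC, ih2 (l + 1) hl, ih2 l (by omega), mul_zero, add_zero]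
    refine ⟨fun l => ?_, hlow⟩
    cases l with
    | zero =>
      have h0 := ih1 0
      rw [add_zero] at h0
      cases q with
      | zero => simp
      | succ q =>
        rw [add_zero, ← add_assoc, lamC, lamC, h0, ih2 q (by omega), add_zero]
        congr 3 <;> push_cast <;> ring
    | succ l =>
      rw [← add_assoc, ← add_assoc, lamC, lamC, add_assoc q l 1, ih1 (l + 1), ih1 l]
      congr 4 <;> push_cast <;> ring

theorem ZeroRow.add {i j : ℤ} {q r : ℕ} (h : ZeroRow P i j q) (h2 : ZeroRow P (i - q) (j - q) r) :
    ZeroRow P i j (q + r) := by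
  intro l hl
  rcases Nat.lt_or_ge l q with h3 | h3
  · exact (lamC_shift P i j q h r).2 l h3
  · obtain ⟨m, rfl⟩ := Nat.exists_eq_add_of_le h3
    rw [(lamC_shift P i j q h r).1 m]
    exact h2 m (by omega)

theorem N_pos : 0 < P.N := by
  have h : (P.ξ ^ P.t) ^ P.n = 1 := by
    rw [← pow_mul, mul_comm, pow_mul, P.primitive.pow_eq_one, one_pow]
  exact orderOf_pos_iff.mpr (isOfFinOrder_iff_pow_eq_one.mpr
    ⟨P.n, by have := P.two_le_n; omega, h⟩)

theorem N_dvd_n : P.N ∣ P.n := by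
  apply orderOf_dvd_of_pow_eq_one
  rw [← pow_mul, mul_comm, pow_mul, P.primitive.pow_eq_one, one_pow]

theorem xi_zpow_t_eq {a b : ℤ} (h : (P.N : ℤ) ∣ a - b) : P.ξ ^ (P.t * a) = P.ξ ^ (P.t * b) := by
  obtain ⟨c, hc⟩ := h
  have : a = b + P.N * c := by linarith
  have h1 : P.ξ ^ ((P.t : ℤ) * P.N) = 1 := by
    rw [zpow_mul, zpow_natCast, zpow_natCast]
    exact pow_orderOf_eq_one _
  rw [this, mul_add, zpow_add₀ (xi_ne_zero P), ← mul_assoc, zpow_mul P.ξ (P.t * P.N), h1, one_zpow,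
    mul_one]

theorem phi_mem (i : ℤ) : 1 ≤ P.phi i ∧ P.phi i ≤ P.N := by
  have h := Int.emod_nonneg (i - 1) (b := (P.N : ℤ)) (by have := N_pos P; omega)
  have h2 := Int.emod_lt_of_pos (i - 1) (b := (P.N : ℤ)) (by have := N_pos P; omega)
  unfold TaftParams.phi
  omega

theorem phi_modEq (i : ℤ) : i ≡ P.phi i [ZMOD P.N] := by
  have h := Int.emod_nonneg (i - 1) (b := (P.N : ℤ)) (by have := N_pos P; omega)
  have h3 := Int.emod_add_mul_ediv (i - 1) P.N
  unfold TaftParams.phi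
  push_cast
  rw [Int.toNat_of_nonneg h, Int.modEq_comm, Int.modEq_iff_dvd]
  exact ⟨(i - 1) / P.N, by linarith⟩

theorem zeroRow_phi (i j : ℤ) : ZeroRow P i j (P.N - P.phi (-i - j) + 1) := by
  apply zeroRow_of_eq
  · omega
  · rw [← mul_sub]
    apply xi_zpow_t_eq
    have h := (phi_modEq P (-i - j)).dvd
    have h2 := phi_mem P (-i - j)
    rw [Nat.add_sub_cancel, Nat.cast_sub h2.2]
    obtain ⟨c, hc⟩ := h
    exact ⟨c - 1, by linear_combination hc⟩

theorem zeroRow_N (i j : ℤ) : ZeroRow P i j P.N := by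
  have h2 := phi_mem P (-i - j)
  have h := zeroRow_phi P i j
  rcases Nat.eq_or_lt_of_le h2.1 with h3 | h3
  · rwa [← h3, Nat.sub_add_cancel (N_pos P)] at h
  · have e : P.N = (P.N - P.phi (-i - j) + 1) + (P.phi (-i - j) - 1) := by omega
    rw [e]
    refine ZeroRow.add P h (zeroRow_of_eq P _ _ _ (by omega) ?_)
    rw [← mul_sub]
    apply xi_zpow_t_eq
    obtain ⟨c, hc⟩ := (phi_modEq P (-i - j)).dvd
    push_cast [Nat.cast_sub h2.2, Nat.sub_sub, Nat.cast_sub (show 1 + 1 ≤ P.phi (-i - j) by omega)]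
    exact ⟨-2 + c, by linear_combination hc⟩

theorem zeroRow_mul (d : ℕ) : ∀ i j : ℤ, ZeroRow P i j (P.N * d) := by
  induction d with
  | zero => intro i j l hl; omega
  | succ d ih =>
    intro i j
    rw [mul_add, mul_one, add_comm]
    exact ZeroRow.add P (zeroRow_N P i j) (ih _ _)

theorem zeroRow_n (i j : ℤ) : ZeroRow P i j P.n := by
  obtain ⟨d, hd⟩ := N_dvd_n P
  rw [hd]
  exact zeroRow_mul P d i j

end TaftAlg

section construction

variable (i j : ℤ) (lam : k)

open Classical in
/-- The index `m` of the last basis vector of `V(ti, j, λ)`: it is `N - φ(-i-j)` if `λ = 0` and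
`n - 1` otherwise. -/
def TaftParams.top : ℕ := if lam = 0 then P.N - P.phi (-i - j) else P.n - 1

namespace TaftAlg

/-- The underlying space of `V(ti, j, λ)`, with standard basis `v_0, …, v_m`. -/
abbrev Space (m : ℕ) (k : Type u) : Type u := Fin (m + 1) → k

/-- The basis vector `v_a`. -/
def vec (m : ℕ) (a : Fin (m + 1)) : Space m k := Pi.single a 1

/-- The operator `g · v_a = ξ ^ (j - a) v_a`. -/
def gOp (m : ℕ) : Module.End k (Space m k) :=
  (Pi.basisFun k (Fin (m + 1))).constr k (fun a => P.ξ ^ (j - (a : ℕ)) • vec m a)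

variable {P} in
/-- The operator `x · v_a = v_{a+1}` for `a < m` and `x · v_m = λ v_0`. -/
def xOp (m : ℕ) : Module.End k (Space m k) :=
  (Pi.basisFun k (Fin (m + 1))).constr k (fun a =>
    if h : (a : ℕ) < m then vec m ⟨a + 1, by omega⟩ else lam • vec m 0)

/-- The coaction `δ(v_a) = ∑_{l = 0}^{a} c_j^{ti}(a, l) ⊗ v_l`. -/
def coactMap (m : ℕ) : Space m k →ₗ[k] TaftAlg P ⊗[k] Space m k :=
  (Pi.basisFun k (Fin (m + 1))).constr k (fun a =>
    ∑ l ∈ Finset.Iic a, coef P (P.t * i) j a l ⊗ₜ[k] vec m l)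

theorem constr_vec {m : ℕ} {W : Type*} [AddCommGroup W] [Module k W] (f : Fin (m + 1) → W)
    (a : Fin (m + 1)) : (Pi.basisFun k (Fin (m + 1))).constr k f (vec m a) = f a := by
  rw [vec, ← Pi.basisFun_apply k (Fin (m + 1)) a, Module.Basis.constr_basis]

theorem gOp_vec (m : ℕ) (a : Fin (m + 1)) :
    gOp P j m (vec m a) = P.ξ ^ (j - (a : ℕ)) • vec m a := by
  rw [gOp, constr_vec]

theorem xOp_vec (m : ℕ) (a : Fin (m + 1)) :
    xOp lam m (vec m a) =
      if h : (a : ℕ) < m then vec m ⟨a + 1, by omega⟩ else lam • vec m 0 := by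
  rw [xOp, constr_vec]

theorem coactMap_vec (m : ℕ) (a : Fin (m + 1)) :
    coactMap P i j m (vec m a) = ∑ l : Fin (m + 1), coef P (P.t * i) j a l ⊗ₜ[k] vec m l := by
  rw [coactMap, constr_vec]
  apply Finset.sum_subset (Finset.subset_univ _)
  intro l _ hl
  have h : (a : ℕ) < l := by simpa using hl
  rw [coef_of_lt P _ _ h, TensorProduct.zero_tmul]

theorem ext_vec {m : ℕ} {W : Type*} [AddCommGroup W] [Module k W] {f f' : Space m k →ₗ[k] W}
    (h : ∀ a, f (vec m a) = f' (vec m a)) : f = f' :=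
  (Pi.basisFun k (Fin (m + 1))).ext (fun a => by rw [Pi.basisFun_apply]; exact h a)

theorem gOp_pow_vec (m b : ℕ) (a : Fin (m + 1)) :
    (gOp P j m ^ b) (vec m a) = P.ξ ^ ((b : ℤ) * (j - (a : ℕ))) • vec m a := by
  induction b with
  | zero => simp
  | succ b ih =>
    rw [pow_succ', Module.End.mul_apply, ih, map_smul, gOp_vec, smul_smul,
      ← zpow_add₀ (xi_ne_zero P)]
    congr 2
    push_cast
    ring

theorem xi_zpow_n_mul (a : ℤ) : P.ξ ^ ((P.n : ℤ) * a) = 1 := by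
  rw [zpow_mul, zpow_natCast, P.primitive.pow_eq_one, one_zpow]

theorem gOp_pow_n (m : ℕ) : gOp P j m ^ P.n = 1 := by
  apply ext_vec
  intro a
  rw [gOp_pow_vec, xi_zpow_n_mul, one_smul]
  rfl

theorem top_eq_of_ne (h : lam ≠ 0) : P.top i j lam + 1 = P.n := by
  have := P.two_le_n
  rw [TaftParams.top, if_neg h]
  omega

theorem xOp_gOp (m : ℕ) (hm : lam ≠ 0 → m + 1 = P.n) :
    xOp lam m * gOp P j m = P.ξ • (gOp P j m * xOp lam m) := by
  apply ext_vec
  intro a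
  rw [Module.End.mul_apply, LinearMap.smul_apply, Module.End.mul_apply, gOp_vec, map_smul, xOp_vec]
  by_cases h : (a : ℕ) < m
  · rw [dif_pos h, gOp_vec, smul_smul, ← zpow_one_add₀ (xi_ne_zero P)]
    congr 2
    push_cast
    ring
  · rw [dif_neg h]
    by_cases hl : lam = 0
    · simp [hl]
    · have e : (a : ℕ) + 1 = P.n := by rw [← hm hl]; have := a.2; omega
      rw [map_smul, gOp_vec, smul_smul, smul_smul, smul_smul]
      congr 1
      have e2 : (1 : ℤ) + (j - ((0 : Fin (m + 1)) : ℕ)) = (j - (a : ℕ)) + P.n * 1 := by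
        rw [← e]; push_cast [Fin.val_zero]; ring
      have hB : P.ξ * P.ξ ^ (j - ((0 : Fin (m + 1)) : ℕ)) = P.ξ ^ (j - (a : ℕ)) := by
        rw [← zpow_one_add₀ (xi_ne_zero P), e2, zpow_add₀ (xi_ne_zero P), xi_zpow_n_mul, mul_one]
      rw [← hB]
      ring

/-- The action of `H` on `V(ti, j, λ)`. -/
def actHom : TaftAlg P →ₐ[k] Module.End k (Space (P.top i j lam) k) :=
  lift (xOp lam _) (gOp P j _) (gOp_pow_n P j _) (xOp_gOp P j lam _ (top_eq_of_ne P i j lam))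

theorem actHom_x : actHom P i j lam (x P) = xOp lam _ := lift_x _ _ _ _

theorem actHom_g : actHom P i j lam (g P) = gOp P j _ := lift_g _ _ _ _

/-- The twisted action of `x` on `H ⊗ V`. -/
theorem ydOp_x {V : Type*} [AddCommGroup V] [Module k V] (act : TaftAlg P →ₐ[k] Module.End k V)
    (h : TaftAlg P) (v : V) :
    ydOp act ((Coalgebra.comul (R := k) (A := TaftAlg P)).lTensor _
      (Coalgebra.comul (R := k) (x P))) (h ⊗ₜ v) =
    (x P * h * gz P (-P.t)) ⊗ₜ (act (g P) ^ P.t) v + (h * gz P (-P.t)) ⊗ₜ act (x P) v +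
      (h * HopfAlgebra.antipode k (x P)) ⊗ₜ v := by
  have e : Coalgebra.comul (R := k) (g P ^ P.t) = (g P ^ P.t) ⊗ₜ (g P ^ P.t) := by
    rw [Bialgebra.comul_pow, comul_g, Algebra.TensorProduct.tmul_pow]
  rw [comul_x, map_add, LinearMap.lTensor_tmul, LinearMap.lTensor_tmul, comul_x, e,
    TensorProduct.tmul_add, map_add, map_add, LinearMap.add_apply, LinearMap.add_apply,
    ydOp_tmul, ydOp_tmul, ydOp_tmul, antipode_g_pow, map_pow, map_one, one_mul, add_assoc]
  rfl

theorem ydOp_g {V : Type*} [AddCommGroup V] [Module k V] (act : TaftAlg P →ₐ[k] Module.End k V)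
    (h : TaftAlg P) (v : V) :
    ydOp act ((Coalgebra.comul (R := k) (A := TaftAlg P)).lTensor _
      (Coalgebra.comul (R := k) (g P))) (h ⊗ₜ v) =
    (g P * h * gz P (-1)) ⊗ₜ act (g P) v := by
  have e : HopfAlgebra.antipode k (g P) = gz P (-1) := S_g P
  rw [comul_g, LinearMap.lTensor_tmul, comul_g, ydOp_tmul, e]

theorem g_conj_coef (i j : ℤ) (a l : ℕ) :
    g P * coef P i j a l * gz P (-1) = P.ξ ^ ((l : ℤ) - a) • coef P i j a l := by
  rcases Nat.lt_or_ge a l with h | h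
  · rw [coef_of_lt P _ _ h]; simp
  · have key : ∀ b : ℕ, gz P 1 * x P ^ b = P.ξ ^ (-(b : ℤ)) • (x P ^ b * gz P 1) := by
      intro b
      induction b with
      | zero => simp
      | succ b ih =>
        rw [pow_succ, ← mul_assoc, ih, smul_mul_assoc, mul_assoc, gz_mul_x, mul_smul_comm,
          smul_smul, ← mul_assoc, ← zpow_add₀ (xi_ne_zero P)]
        congr 2
        push_cast
        ring
    rw [coef_eq, ← gz_one, mul_smul_comm, smul_mul_assoc, ← mul_assoc, key, smul_mul_assoc,
      smul_mul_assoc, mul_assoc, mul_assoc, ← gz_add, ← gz_add, smul_comm]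
    congr 2
    · rw [Nat.cast_sub h]; congr 1; ring
    · congr 2; ring

theorem row_succ_top (l : ℕ) (hl : l ≤ P.top i j lam) :
    coef P (P.t * i) j (P.top i j lam + 1) l = 0 := by
  have h : ZeroRow P i j (P.top i j lam + 1) := by
    by_cases h : lam = 0
    · rw [TaftParams.top, if_pos h]; exact zeroRow_phi P i j
    · rw [top_eq_of_ne P i j lam h]; exact zeroRow_n P i j
  rw [coef_eq, h l (by omega), zero_smul]

theorem lam_smul_coef_top :
    lam • (coef P (P.t * i) j (P.top i j lam) (P.top i j lam) * gz P (-P.t)) =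
      lam • coef P (P.t * i) j 0 0 := by
  by_cases h : lam = 0
  · simp [h]
  · have e : (P.t * i - (P.top i j lam : ℕ) * P.t + (-P.t) : ℤ) = P.t * i + P.n * (-P.t) := by
      rw [← top_eq_of_ne P i j lam h]; push_cast; ring
    have e2 : gz P (P.n * (-P.t)) = 1 := by
      rw [gz, zpow_mul, zpow_natCast]
      have : gUnit P ^ P.n = 1 := Units.ext (by simpa [gUnit] using g_pow_n P)
      rw [this, one_zpow, Units.val_one]
    rw [coef_eq, lamC_self, one_smul, Nat.sub_self, pow_zero, one_mul, ← gz_add, e, gz_add, e2,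
      mul_one, coef]

theorem compat_g (a : Fin (P.top i j lam + 1)) :
    coactMap P i j _ (actHom P i j lam (g P) (vec _ a)) =
    ydOp (actHom P i j lam) ((Coalgebra.comul (R := k) (A := TaftAlg P)).lTensor _
      (Coalgebra.comul (R := k) (g P))) (coactMap P i j _ (vec _ a)) := by
  rw [actHom_g, gOp_vec, map_smul, coactMap_vec, map_sum, Finset.smul_sum]
  apply Finset.sum_congr rfl
  intro l _
  rw [ydOp_g, actHom_g, gOp_vec, g_conj_coef, TensorProduct.tmul_smul, TensorProduct.smul_tmul',
    TensorProduct.smul_tmul', smul_smul, ← zpow_add₀ (xi_ne_zero P)]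
  congr 3
  ring

theorem compat_x (a : Fin (P.top i j lam + 1)) :
    coactMap P i j _ (actHom P i j lam (x P) (vec _ a)) =
    ydOp (actHom P i j lam) ((Coalgebra.comul (R := k) (A := TaftAlg P)).lTensor _
      (Coalgebra.comul (R := k) (x P))) (coactMap P i j _ (vec _ a)) := by
  have hS : HopfAlgebra.antipode k (g P ^ P.t) = gz P (-P.t) := antipode_g_pow P P.t
  have hx : ∀ l : Fin (P.top i j lam + 1), (x P * coef P (P.t * i) j a l * gz P (-P.t)) ⊗ₜ[k]
      ((actHom P i j lam (g P) ^ P.t) (vec _ l)) = (P.ξ ^ (P.t * (j - (l : ℕ))) •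
      (x P * coef P (P.t * i) j a l * gz P (-P.t))) ⊗ₜ[k] vec _ l := by
    intro l
    rw [actHom_g, gOp_pow_vec, TensorProduct.tmul_smul, TensorProduct.smul_tmul']
  have main : ydOp (actHom P i j lam) ((Coalgebra.comul (R := k) (A := TaftAlg P)).lTensor _
      (Coalgebra.comul (R := k) (x P))) (coactMap P i j _ (vec _ a)) =
      (∑ l : Fin (P.top i j lam + 1), coef P (P.t * i) j (a + 1) l ⊗ₜ[k] vec _ l) +
      (coef P (P.t * i) j a (P.top i j lam) * gz P (-P.t)) ⊗ₜ[k] (lam • vec _ 0) := by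
    rw [coactMap_vec, map_sum]
    simp only [ydOp_x, hx, Finset.sum_add_distrib]
    simp only [actHom_x, xOp_vec]
    rw [Fin.sum_univ_castSucc
      (fun l : Fin (P.top i j lam + 1) => (coef P (P.t * i) j a l * gz P (-P.t)) ⊗ₜ[k] _)]
    rw [Fin.sum_univ_succ
      (fun l : Fin (P.top i j lam + 1) => coef P (P.t * i) j (a + 1) l ⊗ₜ[k] vec _ l)]
    rw [Fin.sum_univ_succ
      (fun l : Fin (P.top i j lam + 1) => (_ : TaftAlg P) ⊗ₜ[k] vec _ l)]
    rw [Fin.sum_univ_succ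
      (fun l : Fin (P.top i j lam + 1) =>
        (coef P (P.t * i) j a l * HopfAlgebra.antipode k (x P)) ⊗ₜ[k] vec _ l)]
    simp only [coef, hS, TensorProduct.add_tmul, Finset.sum_add_distrib, Fin.val_succ,
      Fin.val_zero, Fin.val_castSucc, Fin.val_last, lt_self_iff_false, dite_false, Fin.is_lt,
      dite_true, Nat.cast_zero, sub_zero]
    have hz : ∀ l : Fin (P.top i j lam), (⟨(l : ℕ) + 1, by omega⟩ : Fin (P.top i j lam + 1))
      = l.succ := fun l => rfl
    simp only [hz]
    abel
  rw [main, actHom_x, xOp_vec]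
  by_cases h : (a : ℕ) < P.top i j lam
  · rw [dif_pos h, coactMap_vec, coef_of_lt P _ _ h, zero_mul, TensorProduct.zero_tmul, add_zero]
  · have e : (a : ℕ) = P.top i j lam := by have := a.2; omega
    rw [dif_neg h, e, Finset.sum_eq_zero, zero_add, map_smul, coactMap_vec, Fin.sum_univ_succ,
      Finset.sum_eq_zero, add_zero, Fin.val_zero, TensorProduct.smul_tmul', ← lam_smul_coef_top,
      ← TensorProduct.smul_tmul', TensorProduct.tmul_smul]
    · intro l _
      rw [Fin.val_zero, coef_of_lt P _ _ (by simp), TensorProduct.zero_tmul]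
    · intro l _
      rw [row_succ_top P i j lam l (by have := l.2; omega), TensorProduct.zero_tmul]

theorem compat (h : TaftAlg P) (v : Space (P.top i j lam) k) :
    coactMap P i j _ (actHom P i j lam h v) =
    ydOp (actHom P i j lam) ((Coalgebra.comul (R := k) (A := TaftAlg P)).lTensor _
      (Coalgebra.comul (R := k) h)) (coactMap P i j _ v) := by
  induction h using induct generalizing v with
  | hx =>
    have h := ext_vec (f := coactMap P i j _ ∘ₗ actHom P i j lam (x P))
      (f' := ydOp (actHom P i j lam) ((Coalgebra.comul (R := k) (A := TaftAlg P)).lTensor _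
        (Coalgebra.comul (R := k) (x P))) ∘ₗ coactMap P i j _) (compat_x P i j lam)
    exact LinearMap.congr_fun h v
  | hg =>
    have h := ext_vec (f := coactMap P i j _ ∘ₗ actHom P i j lam (g P))
      (f' := ydOp (actHom P i j lam) ((Coalgebra.comul (R := k) (A := TaftAlg P)).lTensor _
        (Coalgebra.comul (R := k) (g P))) ∘ₗ coactMap P i j _) (compat_g P i j lam)
    exact LinearMap.congr_fun h v
  | hs r =>
    have key : ∀ u : TaftAlg P ⊗[k] Space (P.top i j lam) k,
        ydOp (actHom P i j lam) (1 ⊗ₜ (1 ⊗ₜ 1)) u = u := by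
      intro u
      induction u using TensorProduct.induction_on with
      | zero => simp
      | add u₁ u₂ h₁ h₂ => rw [map_add, h₁, h₂]
      | tmul a b => rw [ydOp_tmul, HopfAlgebra.antipode_one]; simp
    rw [Algebra.algebraMap_eq_smul_one, map_smul, map_smul, map_smul, map_smul,
      Bialgebra.comul_one, Algebra.TensorProduct.one_def, LinearMap.lTensor_tmul,
      Bialgebra.comul_one, Algebra.TensorProduct.one_def, LinearMap.smul_apply, LinearMap.smul_apply, key, map_one,
      map_smul]
    rfl
  | hadd a b ha hb => simp only [map_add, LinearMap.add_apply, ha, hb]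
  | hmul a b ha hb =>
    rw [comul_comul_mul, ydOp_mul, map_mul, Module.End.mul_apply, Module.End.mul_apply, ha, hb]

theorem vec_induct {m : ℕ} {C : Space m k → Prop} (h0 : C (vec m 0))
    (hs : ∀ a : ℕ, (ha : a < m) → C (vec m ⟨a, by omega⟩) → C (xOp lam m (vec m ⟨a, by omega⟩)))
    (a : Fin (m + 1)) : C (vec m a) := by
  obtain ⟨a, ha⟩ := a
  induction a with
  | zero => exact h0
  | succ a ih =>
    have h := hs a (by omega) (ih (by omega))
    rw [xOp_vec, dif_pos (show a < m by omega)] at h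
    exact h

theorem coactMap_vec_zero (m : ℕ) :
    coactMap P i j m (vec m 0) = gz P (P.t * i) ⊗ₜ vec m 0 := by
  rw [coactMap_vec, Fin.sum_univ_succ, Finset.sum_eq_zero, add_zero, Fin.val_zero, coef]
  intro l _
  rw [Fin.val_zero, coef_of_lt P _ _ (by simp), TensorProduct.zero_tmul]

theorem isGroupLike_gz (a : ℤ) : Coalgebra.comul (R := k) (gz P a) = gz P a ⊗ₜ gz P a ∧
    Coalgebra.counit (R := k) (gz P a) = 1 := by
  have h : ∃ b : ℕ, gz P a = g P ^ b := by
    refine ⟨(a % P.n).toNat, ?_⟩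
    have e := Int.emod_add_mul_ediv a P.n
    have hu : gUnit P ^ P.n = 1 := Units.ext (by simpa [gUnit] using g_pow_n P)
    rw [← gz_natCast, Int.toNat_of_nonneg (Int.emod_nonneg _ (by have := P.two_le_n; omega))]
    conv_lhs => rw [← e, gz_add]
    rw [show gz P (P.n * (a / P.n)) = 1 by rw [gz, zpow_mul, zpow_natCast, hu]; simp, mul_one]
  obtain ⟨b, hb⟩ := h
  rw [hb, Bialgebra.comul_pow, Bialgebra.counit_pow, comul_g, counit_g,
    Algebra.TensorProduct.tmul_pow, one_pow]
  exact ⟨rfl, rfl⟩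

theorem counit_vec (a : Fin (P.top i j lam + 1)) : TensorProduct.lid k _
    ((Coalgebra.counit (R := k) (A := TaftAlg P)).rTensor _
      (coactMap P i j (P.top i j lam) (vec _ a))) = vec _ a := by
  refine vec_induct lam (C := fun v => TensorProduct.lid k _
    ((Coalgebra.counit (R := k) (A := TaftAlg P)).rTensor _
      (coactMap P i j (P.top i j lam) v)) = v) ?_ ?_ a
  · rw [coactMap_vec_zero]; simp [(isGroupLike_gz P _).2]
  · intro a ha ih
    have h := compat P i j lam (x P) (vec _ ⟨a, by omega⟩)
    rw [actHom_x] at h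
    have key : ∀ u : TaftAlg P ⊗[k] Space (P.top i j lam) k, TensorProduct.lid k _
        ((Coalgebra.counit (R := k) (A := TaftAlg P)).rTensor _
        (ydOp (actHom P i j lam) ((Coalgebra.comul (R := k) (A := TaftAlg P)).lTensor _
          (Coalgebra.comul (R := k) (x P))) u)) =
        xOp lam _ (TensorProduct.lid k _
          ((Coalgebra.counit (R := k) (A := TaftAlg P)).rTensor _ u)) := by
      intro u
      induction u using TensorProduct.induction_on with
      | zero => simp
      | add u₁ u₂ h₁ h₂ => simp only [map_add, h₁, h₂]
      | tmul a b =>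
        rw [ydOp_x]
        simp [Bialgebra.counit_mul, counit_x, (isGroupLike_gz P _).2, actHom_x]
    rw [h, key, ih]

theorem comul_antipode_x : Coalgebra.comul (R := k) (HopfAlgebra.antipode k (x P)) =
    HopfAlgebra.antipode k (x P) ⊗ₜ 1 + gz P (-P.t) ⊗ₜ HopfAlgebra.antipode k (x P) := by
  have e : g P ^ P.t * gz P (-P.t) = 1 := by
    rw [← gz_natCast, ← gz_add]; simp [gz_zero]
  rw [antipode_x, map_neg, Bialgebra.comul_mul, comul_x, (isGroupLike_gz P _).1, add_mul,
    Algebra.TensorProduct.tmul_mul_tmul, Algebra.TensorProduct.tmul_mul_tmul, e, one_mul, neg_add,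
    TensorProduct.neg_tmul, TensorProduct.tmul_neg]

set_option synthInstance.maxHeartbeats 200000 in
theorem coassoc_vec (a : Fin (P.top i j lam + 1)) : TensorProduct.assoc k _ _ _
    ((Coalgebra.comul (R := k) (A := TaftAlg P)).rTensor _
      (coactMap P i j (P.top i j lam) (vec _ a))) =
    (coactMap P i j (P.top i j lam)).lTensor _ (coactMap P i j (P.top i j lam) (vec _ a)) := by
  refine vec_induct lam (C := fun v => TensorProduct.assoc k _ _ _
    ((Coalgebra.comul (R := k) (A := TaftAlg P)).rTensor _
      (coactMap P i j (P.top i j lam) v)) =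
    (coactMap P i j (P.top i j lam)).lTensor _ (coactMap P i j (P.top i j lam) v)) ?_ ?_ a
  · rw [coactMap_vec_zero]; simp [(isGroupLike_gz P _).1, coactMap_vec_zero]
  · intro a ha ih
    have h := compat P i j lam (x P) (vec _ ⟨a, by omega⟩)
    rw [actHom_x] at h
    have hg : ∀ (b : ℕ) (v : Space (P.top i j lam) k),
        coactMap P i j _ ((actHom P i j lam (g P) ^ b) v) =
        TensorProduct.map (LinearMap.mulLeft k (g P ^ b) ∘ₗ LinearMap.mulRight k (gz P (-b)))
          (actHom P i j lam (g P) ^ b) (coactMap P i j _ v) := by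
      intro b
      induction b with
      | zero =>
        intro v
        have e : (1 : Module.End k (Space (P.top i j lam) k)) = LinearMap.id := rfl
        simp [gz_zero, e, TensorProduct.map_id]
      | succ b ih =>
        intro v
        rw [pow_succ', Module.End.mul_apply, compat, ih]
        generalize coactMap P i j (P.top i j lam) v = u
        induction u using TensorProduct.induction_on with
        | zero => simp
        | add u₁ u₂ h₁ h₂ => simp only [map_add, h₁, h₂]
        | tmul c d =>
          have e : gz P (-((b + 1 : ℕ) : ℤ)) = gz P (-b) * gz P (-1) := by
            rw [← gz_add]; congr 1; push_cast; ring
          rw [TensorProduct.map_tmul, TensorProduct.map_tmul, ydOp_g, e]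
          simp [pow_succ', mul_assoc]
    -- Both sides are expressed through one operator on `H ⊗ (H ⊗ V)`.
    let T : TaftAlg P ⊗[k] (TaftAlg P ⊗[k] Space (P.top i j lam) k) →ₗ[k]
        TaftAlg P ⊗[k] (TaftAlg P ⊗[k] Space (P.top i j lam) k) :=
      TensorProduct.map (LinearMap.mulLeft k (x P) ∘ₗ LinearMap.mulRight k (gz P (-P.t)))
        (TensorProduct.map
          (LinearMap.mulLeft k (g P ^ P.t) ∘ₗ LinearMap.mulRight k (gz P (-P.t)))
          (actHom P i j lam (g P) ^ P.t)) +
      TensorProduct.map (LinearMap.mulRight k (gz P (-P.t)))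
        (ydOp (actHom P i j lam) ((Coalgebra.comul (R := k) (A := TaftAlg P)).lTensor _
          (Coalgebra.comul (R := k) (x P)))) +
      TensorProduct.map (LinearMap.mulRight k (HopfAlgebra.antipode k (x P))) LinearMap.id
    have key1 : ∀ u : TaftAlg P ⊗[k] Space (P.top i j lam) k, TensorProduct.assoc k _ _ _
        ((Coalgebra.comul (R := k) (A := TaftAlg P)).rTensor _
        (ydOp (actHom P i j lam) ((Coalgebra.comul (R := k) (A := TaftAlg P)).lTensor _
          (Coalgebra.comul (R := k) (x P))) u)) =
        T (TensorProduct.assoc k _ _ _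
        ((Coalgebra.comul (R := k) (A := TaftAlg P)).rTensor _ u)) := by
      intro u
      induction u using TensorProduct.induction_on with
      | zero => simp
      | add u₁ u₂ h₁ h₂ => simp only [map_add, h₁, h₂]
      | tmul c d =>
        rw [ydOp_x]
        simp only [map_add, LinearMap.rTensor_tmul, Bialgebra.comul_mul, comul_x,
          comul_antipode_x, (isGroupLike_gz P _).1]
        generalize Coalgebra.comul (R := k) c = w
        induction w using TensorProduct.induction_on with
        | zero => simp
        | add u₁ u₂ h₁ h₂ =>
          simp only [add_mul, mul_add, TensorProduct.add_tmul, map_add] at h₁ h₂ ⊢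
          rw [← h₁, ← h₂]
          abel
        | tmul c c' =>
          simp only [T, LinearMap.add_apply, TensorProduct.assoc_tmul, TensorProduct.map_tmul,
            ydOp_x, add_mul, mul_add, TensorProduct.add_tmul, TensorProduct.tmul_add, map_add,
            Algebra.TensorProduct.tmul_mul_tmul, one_mul, mul_one, LinearMap.comp_apply,
            LinearMap.mulLeft_apply, LinearMap.mulRight_apply, LinearMap.id_apply, mul_assoc]
          abel
    have key2 : ∀ u : TaftAlg P ⊗[k] Space (P.top i j lam) k,
        (coactMap P i j (P.top i j lam)).lTensor _
        (ydOp (actHom P i j lam) ((Coalgebra.comul (R := k) (A := TaftAlg P)).lTensor _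
          (Coalgebra.comul (R := k) (x P))) u) =
        T ((coactMap P i j (P.top i j lam)).lTensor _ u) := by
      intro u
      induction u using TensorProduct.induction_on with
      | zero => simp
      | add u₁ u₂ h₁ h₂ => simp only [map_add, h₁, h₂]
      | tmul c d =>
        rw [ydOp_x]
        simp only [map_add, LinearMap.lTensor_tmul, hg, compat, T, LinearMap.add_apply,
          TensorProduct.map_tmul, LinearMap.comp_apply, LinearMap.mulLeft_apply,
          LinearMap.mulRight_apply, LinearMap.id_apply, mul_assoc]
    rw [h, key1, key2, ih]

/-- The Yetter-Drinfeld module `V(ti, j, λ)` over `H(n, t, ξ)`. -/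
def V : YDModule k (TaftAlg P) where
  carrier := Space (P.top i j lam) k
  act := actHom P i j lam
  coact := coactMap P i j (P.top i j lam)
  coassoc v := LinearMap.congr_fun (ext_vec
    (f := (TensorProduct.assoc k _ _ _).toLinearMap ∘ₗ
      (Coalgebra.comul (R := k) (A := TaftAlg P)).rTensor _ ∘ₗ coactMap P i j (P.top i j lam))
    (f' := (coactMap P i j (P.top i j lam)).lTensor _ ∘ₗ coactMap P i j (P.top i j lam))
    (coassoc_vec P i j lam)) v
  counit v := LinearMap.congr_fun (ext_vec
    (f := (TensorProduct.lid k _).toLinearMap ∘ₗ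
      (Coalgebra.counit (R := k) (A := TaftAlg P)).rTensor _ ∘ₗ coactMap P i j (P.top i j lam))
    (f' := LinearMap.id) (counit_vec P i j lam)) v
  compat := compat P i j lam

end TaftAlg

end construction

end Modules

end

-- A morphism out of V(tr,s,λ) is determined by the image of v_0, because v_a = x^a v_0. So
-- classifying isomorphisms means finding every vector of V(ti,j,λ) that can play the role of v_0.
--
-- Such a vector w is an eigenvector of g with coaction g^{tr} ⊗ w. The eigenvalues ξ^{j-a} of g are
-- pairwise distinct, since a runs over at most n consecutive integers; hence w is a nonzero
-- multiple of one v_q (`eigenvector_gOp`). Comparing coactions, row q of the coefficients c must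
-- vanish to the left of the diagonal, and its diagonal entry g^{t(i-q)} must be g^{tr}. The
-- eigenvalue of g gives j - q ≡ s mod n, and the diagonal entry gives i - q ≡ r mod N.
--
-- The entry next to the diagonal in row q is, up to an invertible factor, the product of x with the
-- scalar (1 + u + ... + u^{q-1})(ξ^{tj} - ξ^{t(q-1-i)}), where u = ξ^{-t}. It can vanish only if N
-- divides q or i + j + 1 - q (`dvd_of_lamC_succ_self_eq_zero`). This yields the necessary
-- conditions in `exists_of_isIso`. Conversely, for q ≥ 1 either divisibility makes the whole row
-- vanish below the diagonal, and then v_a ↦ x^a v_q is a morphism; it is bijective when λ ≠ 0, or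
-- when q = 0, provided both modules have the same dimension (`isIso_of_zeroRow`).
--
-- Now p ≡ i + j + 1 mod N with 1 ≤ p ≤ N. For λ = 0 the indices satisfy q < p, which leaves only q
-- = 0. For λ ≠ 0 all q < n are available, so q ≡ 0 or q ≡ p mod N. These residues coincide exactly
-- when p = N. The freedom to change q by multiples of N is what weakens the condition on j from mod
-- n to mod N.

universe u v

/-! ### Yetter-Drinfeld modules over a general Hopf algebra. -/

section Generalities

variable {k : Type u} [Field k] {H : Type v} [Ring H] [HopfAlgebra k H]

/-- Naturality of the twisted action in the module. With the compatibility axiom, it reduces the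
check that an H-linear map preserves coactions to a generating vector. -/
theorem lTensor_ydOp {V W : Type*} [AddCommGroup V] [Module k V] [AddCommGroup W] [Module k W]
    (act : H →ₐ[k] Module.End k V) (act' : H →ₐ[k] Module.End k W) (f : V →ₗ[k] W)
    (hf : ∀ h v, f (act h v) = act' h (f v)) (u : H ⊗[k] (H ⊗[k] H)) (w : H ⊗[k] V) :
    f.lTensor H (ydOp act u w) = ydOp act' u (f.lTensor H w) := by
  induction u using TensorProduct.induction_on with
  | zero => simp
  | add u₁ u₂ h₁ h₂ => simp only [map_add, LinearMap.add_apply, h₁, h₂]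
  | tmul a u =>
    induction u using TensorProduct.induction_on with
    | zero => simp
    | add u₁ u₂ h₁ h₂ => simp only [TensorProduct.tmul_add, map_add, LinearMap.add_apply, h₁, h₂]
    | tmul b c =>
      induction w using TensorProduct.induction_on with
      | zero => simp
      | add w₁ w₂ h₁ h₂ => simp only [map_add, h₁, h₂]
      | tmul h v => rw [ydOp_tmul, LinearMap.lTensor_tmul, LinearMap.lTensor_tmul, ydOp_tmul, hf]

theorem YDModule.IsIso.symm {V W : YDModule k H} (h : V.IsIso W) : W.IsIso V := by
  obtain ⟨f, h₁, h₂⟩ := h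
  refine ⟨f.symm, fun a w => ?_, fun w => ?_⟩
  · rw [LinearEquiv.symm_apply_eq, h₁, LinearEquiv.apply_symm_apply]
  · have h := h₂ (f.symm w)
    rw [LinearEquiv.apply_symm_apply] at h
    rw [h, ← LinearMap.comp_apply, ← LinearMap.lTensor_comp]
    simp

end Generalities

namespace TaftAlg

variable {k : Type u} [Field k] (P : TaftParams k)

/-! ### Facts about H: the order of g and of g^t, and x ≠ 0. -/

theorem gz_eq_gz_iff (a b : ℤ) : gz P a = gz P b ↔ (P.n : ℤ) ∣ a - b := by
  constructor
  · intro h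
    -- The character x ↦ 0, g ↦ ξ shows that g has order exactly n, since ξ is a primitive root.
    let χ : TaftAlg P →ₐ[k] k := lift 0 P.ξ P.primitive.pow_eq_one (by simp)
    have hχ : ∀ c : ℤ, χ (gz P c) = P.ξ ^ c := by
      intro c
      have e : ((Units.map (χ : TaftAlg P →* k) (gUnit P ^ c) : kˣ) : k) = χ (gz P c) := rfl
      rw [← e, map_zpow, Units.val_zpow_eq_zpow_val]
      congr 1
      exact lift_g _ _ _ _
    have h2 := congrArg χ h
    rw [hχ, hχ] at h2
    rw [← P.primitive.zpow_eq_one_iff_dvd, zpow_sub₀ (xi_ne_zero P), h2,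
      div_self (zpow_ne_zero _ (xi_ne_zero P))]
  · rintro ⟨c, hc⟩
    have hu : gUnit P ^ P.n = 1 := Units.ext (by simpa [gUnit] using g_pow_n P)
    rw [show a = P.n * c + b by linarith, gz_add, gz, zpow_mul, zpow_natCast, hu]
    simp

theorem n_dvd_t_mul_iff (a : ℤ) : (P.n : ℤ) ∣ P.t * a ↔ (P.N : ℤ) ∣ a := by
  rw [← P.primitive.zpow_eq_one_iff_dvd, zpow_mul, zpow_natCast]
  exact (IsPrimitiveRoot.orderOf (P.ξ ^ P.t)).zpow_eq_one_iff_dvd a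

/-- On V(0,0,1) the generator x sends v_0 to v_1, which is a different basis vector because n ≥ 2.
-/
theorem x_ne_zero : x P ≠ 0 := by
  intro h
  have h1 := actHom_x P 0 0 1
  have ht : P.top 0 0 (1 : k) + 1 = P.n := top_eq_of_ne P 0 0 1 one_ne_zero
  have h2 := P.two_le_n
  have h3 := LinearMap.congr_fun h1 (vec _ 0)
  rw [h, map_zero, xOp_vec, dif_pos (by simp; omega)] at h3
  have h4 := congrFun h3 ⟨(0 : Fin (P.top 0 0 (1 : k) + 1)) + 1, by simp; omega⟩
  simp [vec] at h4

/-! ### The coefficient next to the diagonal. -/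

theorem binC_of_lt (u : k) (a : ℕ) : ∀ l, a < l → binC u a l = 0 := by
  induction a with
  | zero => intro l h; obtain ⟨l, rfl⟩ := Nat.exists_eq_succ_of_ne_zero h.ne'; simp [binC]
  | succ a ih =>
    intro l h
    obtain ⟨l, rfl⟩ := Nat.exists_eq_succ_of_ne_zero (show l ≠ 0 by omega)
    simp [binC, ih (l + 1) (by omega), ih l (by omega)]

theorem binC_self (u : k) (a : ℕ) : binC u a a = 1 := by
  induction a with
  | zero => simp [binC]
  | succ a ih => simp [binC, ih, binC_of_lt]

theorem binC_succ_self (u : k) (a : ℕ) : binC u (a + 1) a = ∑ s ∈ Finset.range (a + 1), u ^ s := by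
  induction a with
  | zero => simp [binC]
  | succ a ih => rw [binC, ih, binC_self, Finset.sum_range_succ _ (a + 1), mul_one, add_comm]

/-- In the closed formula the product over s reduces to the single factor s = a, and the twisted
binomial is a geometric sum. The two alternatives record which of these vanishes. -/
theorem dvd_of_lamC_succ_self_eq_zero (i j : ℤ) (a : ℕ) (h : lamC P (P.t * i) j (a + 1) a = 0) :
    P.N ∣ a + 1 ∨ (P.N : ℤ) ∣ i + j - a := by
  rw [lamC_formula P _ _ _ _ (Nat.le_succ a), Nat.Ico_succ_singleton, Finset.prod_singleton,
    binC_succ_self, mul_eq_zero] at h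
  rcases h with h | h
  · left
    apply orderOf_dvd_of_pow_eq_one
    -- A vanishing sum 1 + u + ... + u^a forces u^{a+1} = 1; here u is the inverse of ξ^t, whose
    -- order is N.
    have h2 := geom_sum_mul (P.ξ ^ P.t)⁻¹ (a + 1)
    rw [h, zero_mul, inv_pow] at h2
    exact inv_eq_one.mp (sub_eq_zero.mp h2.symm)
  · right
    rw [← n_dvd_t_mul_iff, ← P.primitive.zpow_eq_one_iff_dvd,
      show (P.t : ℤ) * (i + j - a) = P.t * j - (P.t * a - P.t * i) by ring,
      zpow_sub₀ (xi_ne_zero P), sub_eq_zero.mp h, div_self (zpow_ne_zero _ (xi_ne_zero P))]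

/-! ### Necessary conditions for an isomorphism. -/

variable (i j r s : ℤ) (lam : k)

theorem top_lt_n : P.top i j lam < P.n := by
  have := P.two_le_n
  have h1 := phi_mem P (-i - j)
  have h2 := Nat.le_of_dvd (by omega) (N_dvd_n P)
  unfold TaftParams.top
  split_ifs <;> omega

/-- The operator is diagonal with simple spectrum: exponents differing by less than n give distinct
powers of ξ. The bound m < n is essential. -/
theorem eigenvector_gOp (m : ℕ) (hm : m < P.n) (c : k) (w : Space m k) (hw : w ≠ 0)
    (h : gOp P j m w = c • w) :
    ∃ (q : Fin (m + 1)) (b : k), b ≠ 0 ∧ w = b • vec m q ∧ c = P.ξ ^ (j - (q : ℕ)) := by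
  have hg : ∀ a, gOp P j m w a = P.ξ ^ (j - (a : ℕ)) * w a := by
    intro a
    have e : LinearMap.proj a ∘ₗ gOp P j m =
        P.ξ ^ (j - (a : ℕ)) • (LinearMap.proj a : Space m k →ₗ[k] k) := by
      apply ext_vec
      intro b
      rw [LinearMap.comp_apply, gOp_vec]
      by_cases hab : b = a
      · simp [hab]
      · simp [vec, Ne.symm hab]
    exact LinearMap.congr_fun e w
  have hc : ∀ a, w a ≠ 0 → c = P.ξ ^ (j - (a : ℕ)) := by
    intro a ha
    have h2 := hg a
    rw [h, Pi.smul_apply, smul_eq_mul] at h2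
    exact mul_right_cancel₀ ha h2
  obtain ⟨q, hq⟩ := Function.ne_iff.mp hw
  refine ⟨q, w q, hq, ?_, hc q hq⟩
  ext a
  by_cases haq : a = q
  · simp [vec, haq]
  · by_contra h0
    have ha : w a ≠ 0 := by
      intro h1
      apply h0
      simp [vec, haq, h1]
    -- Two nonzero coordinates would share one eigenvalue, so their indices would be congruent mod
    -- n, while both lie in {0, ..., m}.
    have h3 : (P.n : ℤ) ∣ (j - (a : ℕ)) - (j - (q : ℕ)) := by
      rw [← P.primitive.zpow_eq_one_iff_dvd, zpow_sub₀ (xi_ne_zero P), ← hc a ha, ← hc q hq]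
      refine div_self ?_
      rw [hc q hq]
      exact zpow_ne_zero _ (xi_ne_zero P)
    have h4 := Int.eq_zero_of_abs_lt_dvd h3 (by have := a.2; have := q.2; rw [abs_lt]; omega)
    exact haq (Fin.ext (by omega))

theorem coef_of_coactMap_vec_eq (m : ℕ) (q : Fin (m + 1)) (c : TaftAlg P)
    (h : coactMap P i j m (vec m q) = c ⊗ₜ vec m q) (l : Fin (m + 1)) :
    coef P (P.t * i) j q l = if q = l then c else 0 := by
  rw [coactMap_vec] at h
  -- The l-th coordinate functional on the second tensor factor isolates the coefficient of v_l.
  have h2 := congrArg (TensorProduct.rid k (TaftAlg P) ∘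
    (LinearMap.proj l : Space m k →ₗ[k] k).lTensor (TaftAlg P)) h
  simp only [Function.comp_apply, map_sum, LinearMap.lTensor_tmul, TensorProduct.rid_tmul,
    LinearMap.proj_apply, vec, Pi.single_apply, ite_smul, one_smul, zero_smul,
    Finset.sum_ite_eq, Finset.mem_univ, if_true] at h2
  rw [h2]
  simp [eq_comm]

/-- Here q is the index of the basis vector of V(ti,j,λ) onto whose line v_0 is sent. Of the whole
vanishing row, only the entry next to the diagonal is needed. -/
theorem exists_of_isIso (h : (V P r s lam).IsIso (V P i j lam)) :
    ∃ q : ℕ, q ≤ P.top i j lam ∧ (P.N ∣ q ∨ (P.N : ℤ) ∣ i + j + 1 - q) ∧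
      i - q ≡ r [ZMOD P.N] ∧ j - q ≡ s [ZMOD P.n] := by
  obtain ⟨f, h₁, h₂⟩ := h
  let F : Space (P.top r s lam) k ≃ₗ[k] Space (P.top i j lam) k := f
  have hne : F (vec _ 0) ≠ 0 := by
    rw [Ne, LinearEquiv.map_eq_zero_iff]
    intro h
    have := congrFun h 0
    simp [vec] at this
  have hg : F (actHom P r s lam (g P) (vec _ 0)) = actHom P i j lam (g P) (F (vec _ 0)) :=
    h₁ (g P) (vec _ 0)
  have hδ : coactMap P i j _ (F (vec _ 0)) =
      F.toLinearMap.lTensor _ (coactMap P r s _ (vec _ 0)) := h₂ (vec _ 0)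
  rw [actHom_g, actHom_g, gOp_vec, map_smul] at hg
  obtain ⟨q, b, hb, hw, hc⟩ := eigenvector_gOp P j _ (top_lt_n P i j lam) _ _ hne hg.symm
  rw [coactMap_vec_zero, LinearMap.lTensor_tmul, LinearEquiv.coe_coe, hw, map_smul,
    TensorProduct.tmul_smul] at hδ
  -- Cancelling the nonzero scalar b shows that v_q itself has coaction g^{tr} ⊗ v_q.
  have hq := coef_of_coactMap_vec_eq P i j _ q _ (smul_right_injective _ hb hδ)
  refine ⟨q, by have := q.2; omega, ?_, ?_, ?_⟩
  · obtain ⟨a, ha⟩ := q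
    cases a with
    | zero => simp
    | succ a =>
      have h3 := hq ⟨a, by omega⟩
      rw [if_neg (by simp), coef_eq] at h3
      have h4 : lamC P (P.t * i) j (a + 1) a = 0 := by
        refine (smul_eq_zero.mp h3).resolve_right ?_
        simp only [Nat.add_sub_cancel_left, pow_one]
        -- A power of g is invertible, so it can be cancelled, which would leave x = 0.
        intro h5
        apply x_ne_zero P
        have h6 := congrArg (· * gz P (-(P.t * i - (a + 1 : ℕ) * P.t))) h5
        simpa [mul_assoc, ← gz_add, gz_zero] using h6
      rcases dvd_of_lamC_succ_self_eq_zero P i j a h4 with h5 | h5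
      · exact Or.inl h5
      · right
        convert h5 using 1
        push_cast
        ring
  -- The diagonal entry of row q is g^{t(i-q)}, to be compared with g^{tr}.
  · have h3 := hq q
    rw [if_pos rfl, coef_eq, lamC_self, one_smul, Nat.sub_self, pow_zero, one_mul, gz_eq_gz_iff,
      show P.t * i - (q : ℕ) * P.t - P.t * r = P.t * (i - (q : ℕ) - r : ℤ) by ring,
      n_dvd_t_mul_iff] at h3
    exact (Int.modEq_iff_dvd.mpr h3).symm
  · rw [Fin.val_zero] at hc
    apply Int.ModEq.symm
    rw [Int.modEq_iff_dvd, ← P.primitive.zpow_eq_one_iff_dvd, zpow_sub₀ (xi_ne_zero P), ← hc]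
    simp [zpow_ne_zero _ (xi_ne_zero P)]

/-! ### Powers of x on the basis, and construction of isomorphisms. -/

theorem xOp_pow_vec (m q : ℕ) : ∀ (a : ℕ) (h : a + q ≤ m),
    (xOp lam m ^ a) (vec m ⟨q, by omega⟩) = vec m ⟨a + q, by omega⟩ := by
  intro a
  induction a with
  | zero => intro h; simp
  | succ a ih =>
    intro h
    rw [pow_succ', Module.End.mul_apply, ih (by omega), xOp_vec, dif_pos (show a + q < m by omega)]
    congr 2
    simp only
    omega

theorem xOp_pow_vec_zero (m a : ℕ) (h : a ≤ m) :
    (xOp lam m ^ a) (vec m 0) = vec m ⟨a, by omega⟩ :=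
  xOp_pow_vec lam m 0 a h

/-- It suffices to evaluate on v_0: every basis vector is a power of x applied to v_0, and powers of
x commute. This makes v_a ↦ x^a v_q compatible with x at the last basis vector. -/
theorem xOp_pow_top_succ (m : ℕ) : xOp lam m ^ (m + 1) = algebraMap k _ lam := by
  have h0 : (xOp lam m ^ (m + 1)) (vec m 0) = lam • vec m 0 := by
    rw [pow_succ', Module.End.mul_apply, xOp_pow_vec_zero lam m m le_rfl, xOp_vec, dif_neg (by simp)]
  apply ext_vec
  intro a
  have h := xOp_pow_vec_zero lam m a (by omega)
  rw [← h, ← Module.End.mul_apply, (Commute.pow_pow_self _ _ _).eq, Module.End.mul_apply, h0,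
    map_smul, Module.algebraMap_end_apply]

/-- Obtained from the commutation relation rather than from basis formulas, so it remains valid when
q + a exceeds m and the vector wraps around to a multiple of an earlier one. -/
theorem gOp_xOp_pow (m : ℕ) (hm : lam ≠ 0 → m + 1 = P.n) (q a : ℕ) (hq : q ≤ m) :
    gOp P j m ((xOp lam m ^ a) (vec m ⟨q, by omega⟩)) =
      P.ξ ^ (j - q - a) • (xOp lam m ^ a) (vec m ⟨q, by omega⟩) := by
  induction a with
  | zero => simp [gOp_vec]
  | succ a ih =>
    have h := LinearMap.congr_fun (xOp_gOp P j lam m hm) ((xOp lam m ^ a) (vec m ⟨q, by omega⟩))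
    rw [Module.End.mul_apply, ih, LinearMap.smul_apply, Module.End.mul_apply, map_smul] at h
    rw [pow_succ', Module.End.mul_apply, show j - q - (a + 1 : ℕ) = -1 + (j - q - a) by
      push_cast; ring, zpow_add₀ (xi_ne_zero P), zpow_neg_one, mul_smul, h,
      inv_smul_smul₀ (xi_ne_zero P)]

/-- The vanishing row makes v_q behave like an initial basis vector. The condition `hlam` serves
only surjectivity: for λ = 0 and q > 0 the vectors x^a v_q never reach v_0. -/
theorem isIso_of_zeroRow (q : ℕ) (hq : q ≤ P.top i j lam) (htop : P.top r s lam = P.top i j lam)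
    (hz : ZeroRow P i j q) (hlam : lam ≠ 0 ∨ q = 0) (hr : i - q ≡ r [ZMOD P.N])
    (hs : j - q ≡ s [ZMOD P.n]) : (V P r s lam).IsIso (V P i j lam) := by
  let w : Space (P.top i j lam) k := vec _ ⟨q, by omega⟩
  let F : Space (P.top r s lam) k →ₗ[k] Space (P.top i j lam) k :=
    (Pi.basisFun k (Fin (P.top r s lam + 1))).constr k (fun a => (xOp lam _ ^ (a : ℕ)) w)
  have hF : ∀ a, F (vec _ a) = (xOp lam _ ^ (a : ℕ)) w := fun a => constr_vec _ a
  have hFx : ∀ v, F (xOp lam _ v) = xOp lam _ (F v) := by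
    refine LinearMap.congr_fun (ext_vec (f := F ∘ₗ xOp lam _) (f' := xOp lam _ ∘ₗ F) fun a => ?_)
    rw [LinearMap.comp_apply, LinearMap.comp_apply, hF, xOp_vec, ← Module.End.mul_apply,
      ← pow_succ']
    by_cases h : (a : ℕ) < P.top r s lam
    · rw [dif_pos h, hF]
    · have e : (a : ℕ) = P.top i j lam := by have := a.2; omega
      -- Wrap-around: x sends the last source vector to λ v_0, whose image λ v_q is x^{m+1} v_q.
      rw [dif_neg h, map_smul, hF, e, xOp_pow_top_succ, Module.algebraMap_end_apply]
      simp
  have hFg : ∀ v, F (gOp P s _ v) = gOp P j _ (F v) := by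
    refine LinearMap.congr_fun (ext_vec (f := F ∘ₗ gOp P s _) (f' := gOp P j _ ∘ₗ F) fun a => ?_)
    rw [LinearMap.comp_apply, LinearMap.comp_apply, gOp_vec, map_smul, hF,
      gOp_xOp_pow P j lam _ (top_eq_of_ne P i j lam) q a hq]
    congr 1
    rw [← div_eq_one_iff_eq (zpow_ne_zero _ (xi_ne_zero P)), ← zpow_sub₀ (xi_ne_zero P),
      P.primitive.zpow_eq_one_iff_dvd]
    convert hs.dvd using 1
    ring
  have hact : ∀ h v, F (actHom P r s lam h v) = actHom P i j lam h (F v) := by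
    intro h
    induction h using induct with
    | hx => rw [actHom_x, actHom_x]; exact hFx
    | hg => rw [actHom_g, actHom_g]; exact hFg
    | hs c => intro v; rw [AlgHom.commutes, AlgHom.commutes]; simp
    | hadd a b ha hb =>
      intro v
      rw [map_add, map_add, LinearMap.add_apply, LinearMap.add_apply, map_add, ha, hb]
    | hmul a b ha hb =>
      intro v
      rw [map_mul, map_mul, Module.End.mul_apply, Module.End.mul_apply, ha, hb]
  have hF0 : F (vec _ 0) = w := by rw [hF]; simp
  have hw : coactMap P i j _ w = gz P (P.t * r) ⊗ₜ w := by
    have e : coef P (P.t * i) j q q = gz P (P.t * r) := by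
      rw [coef_eq, lamC_self, one_smul, Nat.sub_self, pow_zero, one_mul, gz_eq_gz_iff,
        show P.t * i - q * P.t - P.t * r = P.t * (i - q - r : ℤ) by ring, n_dvd_t_mul_iff]
      exact hr.symm.dvd
    -- Terms left of the diagonal vanish by `hz`, those right of it by triangularity.
    rw [coactMap_vec, Finset.sum_eq_single ⟨q, by omega⟩ _ (by simp), e]
    intro l _ hl
    have hl' : (l : ℕ) ≠ q := fun h => hl (Fin.ext h)
    rcases Nat.lt_or_ge l q with h | h
    · rw [coef_eq, hz l h, zero_smul, TensorProduct.zero_tmul]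
    · rw [coef_of_lt P _ _ (by simp only; omega), TensorProduct.zero_tmul]
  have hco : ∀ v, coactMap P i j _ (F v) = F.lTensor _ (coactMap P r s _ v) := by
    refine LinearMap.congr_fun (ext_vec (f := coactMap P i j _ ∘ₗ F)
      (f' := F.lTensor _ ∘ₗ coactMap P r s _) ?_)
    refine vec_induct lam (C := fun v => (coactMap P i j _ ∘ₗ F) v =
      (F.lTensor _ ∘ₗ coactMap P r s _) v) ?_ ?_
    · rw [LinearMap.comp_apply, LinearMap.comp_apply, hF0, hw, coactMap_vec_zero,
        LinearMap.lTensor_tmul, hF0]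
    · intro a ha ih
      rw [LinearMap.comp_apply, LinearMap.comp_apply] at ih ⊢
      -- Both coactions of x · v arise from those of v by the same twisted operator, by
      -- compatibility and naturality.
      rw [← actHom_x P r s, hact, compat, compat, lTensor_ydOp _ _ F hact, ih]
  have hsurj : Function.Surjective F := by
    have hrange : ∀ v, v ∈ LinearMap.range F → xOp lam _ v ∈ LinearMap.range F := by
      rintro _ ⟨v, rfl⟩
      exact ⟨_, hFx v⟩
    have h0 : vec _ 0 ∈ LinearMap.range F := by
      rcases hlam with h | rfl
      · have hpow : ∀ b, (xOp lam _ ^ b) w ∈ LinearMap.range F := by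
          intro b
          induction b with
          | zero => exact ⟨_, hF0⟩
          | succ b ih => rw [pow_succ', Module.End.mul_apply]; exact hrange _ ih
        -- Going from v_q to v_m takes m - q applications of x; one more gives λ v_0, and λ is
        -- invertible.
        have h1 := hpow (P.top i j lam - q + 1)
        rw [pow_succ', Module.End.mul_apply, xOp_pow_vec lam _ q _ (by omega), xOp_vec,
          dif_neg (by simp only; omega)] at h1
        exact (Submodule.smul_mem_iff _ h).mp h1
      · exact ⟨_, hF0⟩
    have hvec : ∀ a, vec _ a ∈ LinearMap.range F :=
      vec_induct lam (C := fun v => v ∈ LinearMap.range F) h0 (fun a _ ih => hrange _ ih)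
    rw [← LinearMap.range_eq_top, eq_top_iff, ← (Pi.basisFun k _).span_eq, Submodule.span_le]
    rintro _ ⟨a, rfl⟩
    rw [Pi.basisFun_apply]
    exact hvec a
  have hinj : Function.Injective F :=
    (LinearMap.injective_iff_surjective_of_finrank_eq_finrank (by simp [htop])).mpr hsurj
  exact ⟨LinearEquiv.ofBijective F ⟨hinj, hsurj⟩, hact, hco⟩

/-- Only congruences mod N are assumed; the exact congruence of j - q and s mod n is arranged by the
choice of q. -/
theorem isIso_of_lam_ne_zero (hlam : lam ≠ 0) (hi : i - (j - s) ≡ r [ZMOD P.N])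
    (h : (P.N : ℤ) ∣ j - s ∨ (P.N : ℤ) ∣ i + j + 1 - (j - s)) :
    (V P i j lam).IsIso (V P r s lam) := by
  have hn : (0 : ℤ) < P.n := by have := P.two_le_n; omega
  have hNn : (P.N : ℤ) ∣ P.n := Int.natCast_dvd_natCast.mpr (N_dvd_n P)
  -- The index q is the remainder of j - s mod n, hence at most n - 1, the last index when λ ≠ 0.
  obtain ⟨q, hq⟩ := Int.eq_ofNat_of_zero_le (Int.emod_nonneg (j - s) hn.ne')
  have hqn : (q : ℤ) < P.n := hq ▸ Int.emod_lt_of_pos _ hn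
  have hqm : (q : ℤ) ≡ j - s [ZMOD P.n] := hq ▸ Int.mod_modEq _ _
  have hqN := hqm.of_dvd hNn
  have htop := top_eq_of_ne P i j lam hlam
  have htop' := top_eq_of_ne P r s lam hlam
  refine (isIso_of_zeroRow P i j r s lam q (by omega) (by omega) ?_ (Or.inl hlam)
    ((Int.ModEq.rfl.sub hqN).trans hi) ?_).symm
  · by_cases hd : (P.N : ℤ) ∣ q
    · obtain ⟨d, rfl⟩ := Int.natCast_dvd_natCast.mp hd
      exact zeroRow_mul P d i j
    · have h1 : (P.N : ℤ) ∣ i + j + 1 - q := by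
        rcases h with h | h
        · exact absurd (hqN.dvd_iff.mpr h) hd
        · exact ((Int.ModEq.refl (i + j + 1)).sub hqN).dvd_iff.mpr h
      -- The case q = 0 falls under N ∣ q. For q ≥ 1 the factor s = q - 1 occurs in every entry left
      -- of the diagonal, and it is zero here.
      have hq1 : 1 ≤ q := by
        rcases Nat.eq_zero_or_pos q with rfl | h2
        · simp at hd
        · exact h2
      refine zeroRow_of_eq P i j q hq1 ?_
      rw [← mul_sub]
      apply xi_zpow_t_eq
      rw [Nat.cast_sub hq1]
      convert h1 using 1
      push_cast
      ring
  · simpa using (Int.ModEq.refl j).sub hqm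

end TaftAlg

/-! ### The classification. -/

theorem proposition4p11 {k : Type*} [Field k] [IsAlgClosed k] [CharZero k] (P : TaftParams k)
    (i j r s : ℤ) (lam : k) (hlam : lam ≠ 0) (p : ℕ) (hp : p = P.N - P.phi (-i - j) + 1) :
    ((TaftAlg.V P i j 0).IsIso (TaftAlg.V P r s 0) ↔ i ≡ r [ZMOD P.N] ∧ j ≡ s [ZMOD P.n]) ∧
    (p = P.N → ((TaftAlg.V P i j lam).IsIso (TaftAlg.V P r s lam) ↔
      i ≡ r [ZMOD P.N] ∧ j ≡ s [ZMOD P.N])) ∧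
    (p < P.N → ((TaftAlg.V P i j lam).IsIso (TaftAlg.V P r s lam) ↔
      (i ≡ r [ZMOD P.N] ∧ j ≡ s [ZMOD P.N]) ∨
      (r ≡ i - p [ZMOD P.N] ∧ s ≡ j - p [ZMOD P.N]))) := by
  have hNn : (P.N : ℤ) ∣ P.n := Int.natCast_dvd_natCast.mpr (TaftAlg.N_dvd_n P)
  have hphi := TaftAlg.phi_mem P (-i - j)
  -- So p is the representative of i + j + 1 in {1, ..., N}, which turns the second alternative for
  -- q into q ≡ p mod N.
  have hpm : (P.N : ℤ) ∣ i + j + 1 - p := by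
    obtain ⟨c, hc⟩ := (TaftAlg.phi_modEq P (-i - j)).dvd
    rw [hp, Nat.cast_add, Nat.cast_sub hphi.2]
    exact ⟨c - 1, by push_cast; linear_combination hc⟩
  -- For `N ∣ q` the target parameters agree with the source modulo `N`.
  have hmul : ∀ q : ℕ, P.N ∣ q → i - q ≡ r [ZMOD P.N] → j - q ≡ s [ZMOD P.n] →
      i ≡ r [ZMOD P.N] ∧ j ≡ s [ZMOD P.N] := by
    intro q hq hr hs
    have hq0 : (q : ℤ) ≡ 0 [ZMOD P.N] :=
      Int.modEq_zero_iff_dvd.mpr (Int.natCast_dvd_natCast.mpr hq)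
    have hs' := hs.of_dvd hNn
    constructor
    · simpa using hr.add hq0
    · simpa using hs'.add hq0
  have hmulIso : i ≡ r [ZMOD P.N] ∧ j ≡ s [ZMOD P.N] →
      (TaftAlg.V P i j lam).IsIso (TaftAlg.V P r s lam) := by
    rintro ⟨hr, hs⟩
    have hd : (P.N : ℤ) ∣ j - s := hs.symm.dvd
    refine TaftAlg.isIso_of_lam_ne_zero P i j r s lam hlam ?_ (Or.inl hd)
    simpa using hr.sub (Int.modEq_zero_iff_dvd.mpr hd)
  refine ⟨⟨fun h => ?_, ?_⟩, fun hpN => ⟨fun h => ?_, hmulIso⟩, fun hpN => ⟨fun h => ?_, ?_⟩⟩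
  · obtain ⟨q, hq, hd, hr, hs⟩ := TaftAlg.exists_of_isIso P i j r s 0 h.symm
    have hqp : q < p := by rw [TaftParams.top, if_pos rfl] at hq; omega
    have hq0 : q = 0 := by
      rcases hd with hd | hd
      · exact Nat.eq_zero_of_dvd_of_lt hd (by omega)
      -- Since 0 < p - q ≤ N, divisibility by N forces p - q = N, so p = N and q = 0.
      · have h1 : (P.N : ℤ) ∣ p - q := by
          have := hd.sub hpm
          rwa [sub_sub_sub_cancel_left] at this
        have h2 : P.N ∣ p - q := by
          rw [← Nat.cast_sub hqp.le] at h1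
          exact Int.natCast_dvd_natCast.mp h1
        have h3 := Nat.le_of_dvd (by omega) h2
        omega
    subst hq0
    exact ⟨by simpa using hr, by simpa using hs⟩
  · rintro ⟨hr, hs⟩
    refine (TaftAlg.isIso_of_zeroRow P i j r s 0 0 (Nat.zero_le _) ?_ (fun l hl => absurd hl (by omega))
      (Or.inr rfl) (by simpa using hr) (by simpa using hs)).symm
    -- The dimensions agree because φ(-i-j) depends only on the class of i + j mod N, and N divides
    -- n.
    rw [TaftParams.top, TaftParams.top, if_pos rfl, if_pos rfl, TaftParams.phi, TaftParams.phi,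
      ((hr.neg.sub (hs.of_dvd hNn)).sub_right 1).eq]
  · obtain ⟨q, hq, hd, hr, hs⟩ := TaftAlg.exists_of_isIso P i j r s lam h.symm
    refine hmul q ?_ hr hs
    rcases hd with hd | hd
    · exact hd
    -- When p = N the second alternative collapses into the first: N ∣ N - q gives N ∣ q.
    · have h1 := hd.sub hpm
      rw [sub_sub_sub_cancel_left, hpN] at h1
      exact Int.natCast_dvd_natCast.mp ((dvd_sub_right dvd_rfl).mp h1)
  · obtain ⟨q, hq, hd, hr, hs⟩ := TaftAlg.exists_of_isIso P i j r s lam h.symm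
    rcases hd with hd | hd
    · exact Or.inl (hmul q hd hr hs)
    · have h1 : (p : ℤ) ≡ q [ZMOD P.N] := by
        apply Int.ModEq.symm
        rw [Int.modEq_iff_dvd]
        simpa only [sub_sub_sub_cancel_left] using hd.sub hpm
      exact Or.inr ⟨((Int.ModEq.rfl.sub h1).trans hr).symm,
        ((Int.ModEq.rfl.sub h1).trans (hs.of_dvd hNn)).symm⟩
  · rintro (h | ⟨hr, hs⟩)
    · exact hmulIso h
    -- The relevant shift is q ≡ j - s ≡ p mod N, the second way for a row to vanish.
    · have hs' : j - s ≡ p [ZMOD P.N] := by simpa using (Int.ModEq.refl j).sub hs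
      refine TaftAlg.isIso_of_lam_ne_zero P i j r s lam hlam ((Int.ModEq.rfl.sub hs').trans hr.symm)
        (Or.inr ?_)
      exact ((Int.ModEq.refl (i + j + 1)).sub hs').dvd_iff.mpr hpm
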